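/- There is an absolute constant $C>0$ such that the following holds. Let $K,n,d\ge 1$ be integers, $L\in\mathbb R$, $0<\alpha\le 1$. For each machine $k\in\{1,\dots,K\}$ let $H_k=\frac1n\sum_{i=1}^n A_{k,i}$, where $A_{k,1},\dots,A_{k,n}$ are independent random symmetric positive semidefinite $d\times d$ matrices, all $A_{k,i}$ (for all $k$ and $i$) have the same distribution, and all their eigenvalues are almost surely at most $L$. Put $H=\frac1K\sum_{k=1}^K H_k$ and $$\delta=\sqrt{\frac{32L^2\log(Kd/\alpha)}{n}} .$$ Then there is an event of probability at least $1-\alpha$ on which both of the following hold. (i) $\|H_k-H_{k'}\|\le\delta$ in spectral norm for all $k,k'$. Consequently, for all $l_1,\dots,l_K\in\mathbb R^d$ with $\|l_k-l_{k'}\|\le\delta$ for all $k,k'$, the quadratic functions $F_k(w)=\frac12 w^\top H_kw+l_k^\top w$ are $\delta$-related, that is, $\|H_k-H_{k'}\|\le\delta$ and $\|l_k-l_{k'}\|\le\delta$ for all $k,k'$. (ii) For all $l_1,\dots,l_K\in\mathbb R^d$ (with no condition on their differences), let $F_k(w)=\frac12 w^\top H_kw+l_k^\top w$ and $f=\frac1K\sum_{k=1}^K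 F_k$. Let $\lambda>0$ be such that $\lambda I\preceq H$, let $\hat w$ be a minimizer of $f$, let $w^0\in\mathbb R^d$, and let $(w^t)_{t\ge0}$ be any iterates of InexactDANE started at $w^0$ with $\eta=1$, $\mu=\max\{0,8\delta^2/\lambda-\lambda\}$, and $\gamma=1/8$ if $2\sqrt2\,\delta\le\lambda$, $\gamma=\lambda^2/(192\delta^2)$ otherwise. This means that for every $t\ge1$ one has $w^t=\frac1K\sum_{k=1}^K w_k^t$, where each $w_k^t$ satisfies $\|w_k^t-\hat w_k^t\|\le\gamma\|w^{t-1}-\hat w_k^t\|$ for a minimizer $\hat w_k^t$ of $$w\mapsto F_k(w)-\langle\nabla F_k(w^{t-1})-\eta\nabla f(w^{t-1}),w\rangle+\frac\mu2\|w-w^{t-1}\|^2 .$$ Then for every $\epsilon>0$ and every integer $t\ge 0$ with $$t\ \ge\ C\,\max\Big\{1,\ \frac{(L/\lambda)^2}{n}\log\frac{Kd}{\alpha}\Big\}\,\log\frac{L\|w^0-\hat w\|^2}{\epsilon}$$ (every $t\ge 0$ if $w^0=\hat w$) one has $f(w^t)\le f(\hat w)+\epsilon$. -/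

import Mathlib

open MeasureTheory ProbabilityTheory
open scoped RealInnerProductSpace Gradient

namespace InexactDANE

noncomputable section

/-- The product (equivalently, Borel) sigma-algebra on real square matrices. -/
instance matrixMeasurableSpace {d : ℕ} : MeasurableSpace (Matrix (Fin d) (Fin d) ℝ) :=
  inferInstanceAs (MeasurableSpace (Fin d → Fin d → ℝ))

/-- The quadratic function `w ↦ ½ wᵀ H w + lᵀ w` on `ℝ^d`. -/
def quad {d : ℕ} (H : Matrix (Fin d) (Fin d) ℝ) (l : EuclideanSpace ℝ (Fin d))
    (w : EuclideanSpace ℝ (Fin d)) : ℝ :=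
  (1 / 2) * ⟪w, Matrix.toEuclideanCLM (𝕜 := ℝ) H w⟫ + ⟪l, w⟫

/-- The spectral norm of a square matrix: its operator norm for the Euclidean norm. -/
def specNorm {d : ℕ} (M : Matrix (Fin d) (Fin d) ℝ) : ℝ :=
  ‖Matrix.toEuclideanCLM (𝕜 := ℝ) M‖

/-- `δ`-relatedness of the quadratic functions `quad (H k) (l k)`. -/
def DeltaRelated {K d : ℕ} (H : Fin K → Matrix (Fin d) (Fin d) ℝ)
    (l : Fin K → EuclideanSpace ℝ (Fin d)) (δ : ℝ) : Prop :=
  ∀ k k' : Fin K, specNorm (H k - H k') ≤ δ ∧ ‖l k - l k'‖ ≤ δ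

/-- The average `f = (1/K) ∑ₖ Fₖ` of the local functions. -/
def avgFun {K d : ℕ} (F : Fin K → EuclideanSpace ℝ (Fin d) → ℝ)
    (w : EuclideanSpace ℝ (Fin d)) : ℝ :=
  (1 / (K : ℝ)) * ∑ k, F k w

/-- The objective of the local subproblem of machine `k` at the current point `v`:
`Fₖ(w) - ⟨∇Fₖ(v) - η ∇f(v), w⟩ + (μ/2) ‖w - v‖²`. -/
def subproblem {K d : ℕ} (F : Fin K → EuclideanSpace ℝ (Fin d) → ℝ) (η μ : ℝ) (k : Fin K)
    (v w : EuclideanSpace ℝ (Fin d)) : ℝ :=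
  F k w - ⟪∇ (F k) v - η • ∇ (avgFun F) v, w⟫ + μ / 2 * ‖w - v‖ ^ 2

/-- `u` is a `γ`-inexact minimizer of `g` relative to the current point `v`: its distance to a
minimizer is at most `γ` times the distance of `v` to that minimizer. -/
def IsInexactMin {d : ℕ} (g : EuclideanSpace ℝ (Fin d) → ℝ) (γ : ℝ)
    (v u : EuclideanSpace ℝ (Fin d)) : Prop :=
  ∃ uhat : EuclideanSpace ℝ (Fin d),
    IsMinOn g Set.univ uhat ∧ ‖u - uhat‖ ≤ γ * ‖v - uhat‖

/-- `w` is a sequence of iterates of InexactDANE started at `w0`. In each round every machine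
returns an arbitrary `γ`-inexact minimizer of its subproblem, and these points are averaged. -/
def IsIterates {K d : ℕ} (F : Fin K → EuclideanSpace ℝ (Fin d) → ℝ) (η μ γ : ℝ)
    (w0 : EuclideanSpace ℝ (Fin d)) (w : ℕ → EuclideanSpace ℝ (Fin d)) : Prop :=
  w 0 = w0 ∧ ∀ t : ℕ, ∃ u : Fin K → EuclideanSpace ℝ (Fin d),
    (∀ k, IsInexactMin (subproblem F η μ k (w t)) γ (w t) (u k)) ∧
      w (t + 1) = (1 / (K : ℝ)) • ∑ k, u k

/-- The regularization parameter `μ = max {0, 8δ²/lam - lam}`. -/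
def muParam (lam δ : ℝ) : ℝ := max 0 (8 * δ ^ 2 / lam - lam)

open Classical in
/-- The inexactness parameter: `1/8` if `2√2 δ ≤ lam`, and `lam²/(192 δ²)` otherwise. -/
def gammaParam (lam δ : ℝ) : ℝ :=
  if 2 * √2 * δ ≤ lam then 1 / 8 else lam ^ 2 / (192 * δ ^ 2)

/-- The relatedness parameter `δ = √(32 L² log(K d / α) / n)`. -/
def deltaParam (L : ℝ) (K d n : ℕ) (α : ℝ) : ℝ :=
  √(32 * L ^ 2 * Real.log ((K : ℝ) * d / α) / n)

/-- The average `(1/m) ∑ᵢ Mᵢ` of `m` square matrices. -/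
def avgMat {m d : ℕ} (M : Fin m → Matrix (Fin d) (Fin d) ℝ) : Matrix (Fin d) (Fin d) ℝ :=
  (1 / (m : ℝ)) • ∑ i, M i

end

end InexactDANE

/-! The good event depends only on the Hessians; everything about the linear terms and the iterates
is deterministic on it.

Deterministic part. In one round put e = w^{t-1} - ŵ, p_k = w^{t-1} - ŵ_k^t, r_k = w_k^t - ŵ_k^t.
Since all functions are quadratic, local stationarity reads (H_k + μ) p_k = H e
(`stationary_subproblem`), and the new error is the average of e - p_k + r_k. If 8δ² ≤ λ², then μ =
0 and each machine contracts on its own (`norm_average_le_of_small`). Otherwise compare p_k with q =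
(H + μ)⁻¹ H e. The error e - q gains a relative λ/(λ + μ) = λ²/(8δ²), while p_k - q is of first
order in H_k - H, which can exceed this gain. Averaging removes the first order because the H_k - H
sum to zero; the second-order remainder is affordable (`norm_average_le_of_large`). The resulting
factor 1 - λ²/(12δ²), with the value of δ² inserted, gives the stated complexity
(`avgFun_iterate_le`).

Probabilistic part. Closeness of the H_k follows from a matrix Hoeffding bound. Its core is
`trace_exp_le`, a second-order expansion of tr exp obtained by comparing two eigenbases entry by
entry, in place of Golden–Thompson or Lieb. Adding one independent centred summand of norm at most r
≤ 1 then multiplies E tr exp by at most exp(r²) (`integral_trace_exp_sum_le`). Markov's inequality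
and a union bound over the machines finish (`exists_related_event`). -/

namespace InexactDANE

/-! ### One-round contraction for abstract operators. -/

section Contraction

variable {E : Type*} [NormedAddCommGroup E] [InnerProductSpace ℝ E]

lemma norm_average_le {V : Type*} [SeminormedAddCommGroup V] [NormedSpace ℝ V] {K : ℕ}
    (hK : 0 < K) {x : Fin K → V} {R : ℝ} (h : ∀ k, ‖x k‖ ≤ R) :
    ‖(1 / (K : ℝ)) • ∑ k, x k‖ ≤ R := by
  have hK' : (0 : ℝ) < K := by exact_mod_cast hK
  rw [norm_smul, Real.norm_of_nonneg (by positivity)]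
  have : ‖∑ k, x k‖ ≤ K * R := by
    simpa using norm_sum_le_of_le Finset.univ (fun k _ => h k)
  calc 1 / (K : ℝ) * ‖∑ k, x k‖ ≤ 1 / (K : ℝ) * (K * R) := by gcongr
    _ = R := by field_simp

lemma average_const {V : Type*} [AddCommGroup V] [Module ℝ V] {K : ℕ} (hK : 0 < K) (x : V) :
    (1 / (K : ℝ)) • ∑ _k : Fin K, x = x := by
  have hK' : (K : ℝ) ≠ 0 := by exact_mod_cast hK.ne'
  simp only [Finset.sum_const, Finset.card_univ, Fintype.card_fin]
  rw [← Nat.cast_smul_eq_nsmul ℝ, smul_smul, one_div_mul_cancel hK', one_smul]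

/-- Cauchy–Schwarz. It replaces a norm bound on the inverse of a coercive operator, so that no
inverse has to be formed. -/
lemma mul_norm_le_norm_of_coercive {b : ℝ} {x y : E} (h : b * ‖x‖ ^ 2 ≤ ⟪x, y⟫) :
    b * ‖x‖ ≤ ‖y‖ := by
  rcases (norm_nonneg x).eq_or_lt' with h0 | h0
  · rw [h0]; simp
  · have := h.trans (real_inner_le_norm x y)
    nlinarith

/-- The exact minimizers of the local subproblems when no regularization is needed. -/
lemma norm_sub_le_of_small {T S : E →L[ℝ] E} {lam δ : ℝ} (hlam : 0 < lam)
    (hδ : 8 * δ ^ 2 ≤ lam ^ 2) (hδ0 : 0 ≤ δ) (hS : ∀ x, lam * ‖x‖ ^ 2 ≤ ⟪x, S x⟫)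
    (hTS : ‖T - S‖ ≤ δ) {e p : E} (hp : T p = S e) : ‖e - p‖ ≤ 5 / 9 * ‖e‖ := by
  have h1 : T (e - p) = (T - S) e := by simp [hp]
  have h2 : (lam - δ) * ‖e - p‖ ^ 2 ≤ ⟪e - p, T (e - p)⟫ := by
    have h3 : ‖(T - S) (e - p)‖ ≤ δ * ‖e - p‖ := (T - S).le_of_opNorm_le hTS _
    have h4 := abs_le.1 (abs_real_inner_le_norm (e - p) ((T - S) (e - p)))
    have h5 : ⟪e - p, T (e - p)⟫ = ⟪e - p, S (e - p)⟫ + ⟪e - p, (T - S) (e - p)⟫ := by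
      rw [← inner_add_right]; simp
    have := hS (e - p)
    nlinarith [norm_nonneg (e - p)]
  have h3 := mul_norm_le_norm_of_coercive h2
  rw [h1] at h3
  have h4 : ‖(T - S) e‖ ≤ δ * ‖e‖ := (T - S).le_of_opNorm_le hTS _
  -- 5/14 is a rational number just above 1/(2√2); it yields δ/(lam - δ) ≤ 5/9.
  have h5 : 14 * δ ≤ 5 * lam := by
    by_contra! h
    nlinarith
  have h6 : 5 * (lam - δ) * ‖e - p‖ ≤ 5 * (δ * ‖e‖) := by linarith
  have h7 : 9 * δ ≤ 5 * (lam - δ) := by linarith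
  have h8 : 9 * (lam - δ) * ‖e - p‖ ≤ 5 * (lam - δ) * ‖e‖ := by
    nlinarith [norm_nonneg e]
  have h9 : 0 < lam - δ := by linarith
  by_contra! h
  nlinarith

/-- One round of the averaged iteration contracts, without regularization. -/
lemma norm_average_le_of_small {K : ℕ} (hK : 0 < K) {T : Fin K → E →L[ℝ] E} {S : E →L[ℝ] E}
    {lam δ : ℝ} (hlam : 0 < lam) (hδ : 8 * δ ^ 2 ≤ lam ^ 2) (hδ0 : 0 ≤ δ)
    (hS : ∀ x, lam * ‖x‖ ^ 2 ≤ ⟪x, S x⟫) (hTS : ∀ k, ‖T k - S‖ ≤ δ) {e : E} {p r : Fin K → E}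
    (hp : ∀ k, T k (p k) = S e) (hr : ∀ k, ‖r k‖ ≤ 1 / 8 * ‖p k‖) :
    ‖(1 / (K : ℝ)) • ∑ k, (e - p k + r k)‖ ≤ 3 / 4 * ‖e‖ := by
  -- Each machine contracts by itself: 5/9 + (1/8)(1 + 5/9) = 3/4.
  refine norm_average_le hK fun k => ?_
  have h1 := norm_sub_le_of_small hlam hδ hδ0 hS (hTS k) (hp k)
  have h2 : ‖p k‖ ≤ ‖e‖ + ‖e - p k‖ := by
    simpa using norm_sub_le e (e - p k)
  have := norm_add_le (e - p k) (r k)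
  linarith [hr k]

variable [FiniteDimensional ℝ E]

/-- One round of the averaged iteration contracts, with regularization. -/
lemma norm_average_le_of_large {K : ℕ} (hK : 0 < K) {T : Fin K → E →L[ℝ] E} {S : E →L[ℝ] E}
    {lam δ μ : ℝ} (hlam : 0 < lam) (hδ : lam ^ 2 < 8 * δ ^ 2) (hδ0 : 0 < δ)
    (hμ : μ = 8 * δ ^ 2 / lam - lam)
    (hS : ∀ x, lam * ‖x‖ ^ 2 ≤ ⟪x, S x⟫) (hT : ∀ k x, 0 ≤ ⟪x, T k x⟫)
    (havg : (1 / (K : ℝ)) • ∑ k, T k = S)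
    (hTS : ∀ k, ‖T k - S‖ ≤ δ) {e : E} {p r : Fin K → E}
    (hp : ∀ k, T k (p k) + μ • p k = S e)
    (hr : ∀ k, ‖r k‖ ≤ lam ^ 2 / (192 * δ ^ 2) * ‖p k‖) :
    ‖(1 / (K : ℝ)) • ∑ k, (e - p k + r k)‖ ≤ (1 - lam ^ 2 / (12 * δ ^ 2)) * ‖e‖ := by
  have hlm : lam * μ = 8 * δ ^ 2 - lam ^ 2 := by rw [hμ]; field_simp
  have hμ0 : 0 < μ := by
    by_contra! h
    nlinarith
  -- A coercivity constant for every `T k + μ`: `T k` is bounded below both by 0 and by `lam - δ`.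
  -- The second bound is needed when `lam²` is near `8δ²`, where μ tends to 0.
  set b : ℝ := μ + max 0 (lam - δ) with hb
  have hb0 : 0 < b := by have := le_max_left 0 (lam - δ); linarith
  have hlb : 5 * δ ^ 2 ≤ lam * b := by
    rw [hb, mul_add, hlm]
    rcases le_total lam δ with h | h
    · rw [max_eq_left (by linarith)]; nlinarith
    · rw [max_eq_right (by linarith)]
      have : lam ≤ 3 * δ := by
        by_contra! h'
        nlinarith
      nlinarith
  have hδμ : 4 * (δ + μ) ≤ 5 * b := by
    have : 4 * (lam * δ + lam * μ) ≤ 5 * (lam * μ + lam * max 0 (lam - δ)) := by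
      rw [hlm]
      rcases le_total lam δ with h | h
      · rw [max_eq_left (by linarith)]; nlinarith
      · rw [max_eq_right (by linarith)]
        nlinarith [sq_nonneg (8 * lam - 9 * δ)]
    rw [hb]
    by_contra! h'
    nlinarith
  have hcoer : ∀ k x, b * ‖x‖ ^ 2 ≤ ⟪x, T k x + μ • x⟫ := by
    intro k x
    have h3 : ‖(T k - S) x‖ ≤ δ * ‖x‖ := (T k - S).le_of_opNorm_le (hTS k) _
    have h4 := abs_le.1 (abs_real_inner_le_norm x ((T k - S) x))
    have h5 : ⟪x, T k x⟫ = ⟪x, S x⟫ + ⟪x, (T k - S) x⟫ := by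
      rw [← inner_add_right]; simp
    have h6 := hS x
    have h7 := hT k x
    rw [inner_add_right, inner_smul_right, real_inner_self_eq_norm_sq, hb]
    rcases le_total lam δ with h | h
    · rw [max_eq_left (by linarith)]; nlinarith
    · rw [max_eq_right (by linarith)]; nlinarith [norm_nonneg x]
  have hcoerS : ∀ x, (lam + μ) * ‖x‖ ^ 2 ≤ ⟪x, S x + μ • x⟫ := by
    intro x
    rw [inner_add_right, inner_smul_right, real_inner_self_eq_norm_sq]
    linarith [hS x]
  have hc : 0 < lam + μ := by linarith
  -- `q` is the exact step of a fictitious machine holding the averaged Hessian.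
  obtain ⟨q, hq⟩ : ∃ q, S q + μ • q = S e := by
    let B : E →ₗ[ℝ] E := (S : E →ₗ[ℝ] E) + μ • LinearMap.id
    have hinj : Function.Injective B := by
      rw [← LinearMap.ker_eq_bot, LinearMap.ker_eq_bot']
      intro x hx
      have h1 : S x + μ • x = 0 := by simpa [B] using hx
      have h2 := mul_norm_le_norm_of_coercive (hcoerS x)
      rw [h1, norm_zero] at h2
      have : ‖x‖ ≤ 0 := by
        by_contra! h
        nlinarith
      simpa using this
    obtain ⟨q, hq⟩ := (LinearMap.injective_iff_surjective.1 hinj) (S e)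
    exact ⟨q, by simpa [B] using hq⟩
  have hqe : (lam + μ) * ‖e - q‖ ≤ μ * ‖e‖ := by
    have h1 : S (e - q) + μ • (e - q) = μ • e := by
      rw [map_sub, smul_sub, ← hq]; abel
    have := mul_norm_le_norm_of_coercive (hcoerS (e - q))
    rwa [h1, norm_smul, Real.norm_of_nonneg hμ0.le] at this
  -- `S (e - q) = μ q` and positivity of `S` make the inner product of `e - q` and `q` nonnegative.
  have hqn : ‖q‖ ≤ ‖e‖ := by
    have h1 : S (e - q) = μ • q := by rw [map_sub, ← hq]; abel
    have h2 := hS (e - q)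
    rw [h1, inner_smul_right] at h2
    have h3 : 0 ≤ ⟪e - q, q⟫ := by
      by_contra! h
      nlinarith [sq_nonneg ‖e - q‖]
    have h4 := norm_add_sq_real (e - q) q
    rw [sub_add_cancel] at h4
    refine (sq_le_sq₀ (norm_nonneg _) (norm_nonneg _)).1 ?_
    nlinarith [sq_nonneg ‖e - q‖]
  have hpq : ∀ k, b * ‖p k - q‖ ≤ δ * ‖e‖ := by
    intro k
    have h1 : T k (p k - q) + μ • (p k - q) = -((T k - S) q) := by
      have := hp k
      rw [← hq] at this
      rw [map_sub, smul_sub, sub_add_sub_comm, this]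
      simp
    have h2 := mul_norm_le_norm_of_coercive (hcoer k (p k - q))
    rw [h1, norm_neg] at h2
    have h3 : ‖(T k - S) q‖ ≤ δ * ‖q‖ := (T k - S).le_of_opNorm_le (hTS k) _
    nlinarith
  have hpe : ∀ k, ‖p k‖ ≤ 9 / 4 * ‖e‖ := by
    intro k
    have h1 : T k (e - p k) + μ • (e - p k) = (T k - S) e + μ • e := by
      have := hp k
      rw [map_sub, smul_sub, sub_add_sub_comm, this]
      simp; abel
    have h2 := mul_norm_le_norm_of_coercive (hcoer k (e - p k))
    rw [h1] at h2
    have h3 : ‖(T k - S) e‖ ≤ δ * ‖e‖ := (T k - S).le_of_opNorm_le (hTS k) _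
    have h4 := norm_add_le ((T k - S) e) (μ • e)
    rw [norm_smul, Real.norm_of_nonneg hμ0.le] at h4
    have h5 : ‖p k‖ ≤ ‖e‖ + ‖e - p k‖ := by simpa using norm_sub_le e (e - p k)
    have h6 : 4 * b * ‖e - p k‖ ≤ 5 * b * ‖e‖ := by nlinarith [norm_nonneg e]
    have h7 : 4 * ‖e - p k‖ ≤ 5 * ‖e‖ := by
      by_contra! h
      nlinarith
    linarith
  set z : ℝ := lam ^ 2 / δ ^ 2 with hz
  have hz0 : 0 ≤ z := by positivity
  -- The averaging gain: in the equation for `P` the terms `(T k - S) q` cancel, leaving `(T k - S)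
  -- (p k - q)`, which is quadratic in δ.
  have hmean : ‖(1 / (K : ℝ)) • ∑ k, (p k - q)‖ ≤ z / 40 * ‖e‖ := by
    set P := (1 / (K : ℝ)) • ∑ k, (p k - q) with hP
    have hzero : (1 / (K : ℝ)) • ∑ k, (T k - S) = 0 := by
      rw [Finset.sum_sub_distrib, smul_sub, havg, sub_eq_zero]
      exact (average_const hK S).symm
    have h1 : S P + μ • P = (1 / (K : ℝ)) • ∑ k, -((T k - S) (p k - q)) := by
      have h2 : ∀ k, S (p k - q) + μ • (p k - q) = -((T k - S) (p k - q)) - (T k - S) q := by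
        intro k
        have := hp k
        rw [← hq] at this
        simp only [map_sub, smul_sub, sub_apply]
        have h4 : T k (p k) = S q + μ • q - μ • p k := by rw [← this]; abel
        rw [h4]; abel
      have h3 : (1 / (K : ℝ)) • ∑ k, (T k - S) q = 0 := by
        have := congrArg (fun f : E →L[ℝ] E => f q) hzero
        simpa [sum_apply] using this
      calc S P + μ • P = (1 / (K : ℝ)) • ∑ k, (S (p k - q) + μ • (p k - q)) := by
            rw [hP, map_smul, map_sum, Finset.sum_add_distrib, smul_add, smul_comm μ,
              Finset.smul_sum (s := Finset.univ) (r := μ)]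
        _ = _ := by
            simp_rw [h2]
            rw [Finset.sum_sub_distrib, smul_sub, h3, sub_zero]
    have h2 : ‖S P + μ • P‖ ≤ δ * (δ / b * ‖e‖) := by
      rw [h1]
      refine norm_average_le hK fun k => ?_
      rw [norm_neg]
      refine ((T k - S).le_of_opNorm_le (hTS k) _).trans ?_
      have : ‖p k - q‖ ≤ δ / b * ‖e‖ := by
        rw [div_mul_eq_mul_div, le_div_iff₀ hb0]; linarith [hpq k]
      gcongr
    have h3 := (mul_norm_le_norm_of_coercive (hcoerS P)).trans h2
    have h4 : lam + μ = 8 * δ ^ 2 / lam := by rw [hμ]; ring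
    rw [h4] at h3
    have h5 : ‖P‖ ≤ lam / (8 * b) * ‖e‖ := by
      have : ‖P‖ = lam / (8 * δ ^ 2) * (8 * δ ^ 2 / lam * ‖P‖) := by field_simp
      rw [this]
      calc _ ≤ lam / (8 * δ ^ 2) * (δ * (δ / b * ‖e‖)) := by gcongr
        _ = _ := by field_simp
    refine h5.trans ?_
    refine mul_le_mul_of_nonneg_right ?_ (norm_nonneg e)
    rw [hz, div_div, div_le_div_iff₀ (by positivity) (by positivity)]
    nlinarith
  have hsplit : (1 / (K : ℝ)) • ∑ k, (e - p k + r k) =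
      (e - q) - (1 / (K : ℝ)) • ∑ k, (p k - q) + (1 / (K : ℝ)) • ∑ k, r k := by
    have : ∀ k, e - p k + r k = (e - q) - (p k - q) + r k := fun k => by abel
    simp_rw [this]
    rw [Finset.sum_add_distrib, Finset.sum_sub_distrib, smul_add, smul_sub, average_const hK]
  have hrm : ‖(1 / (K : ℝ)) • ∑ k, r k‖ ≤ z / 192 * (9 / 4 * ‖e‖) := by
    refine norm_average_le hK fun k => (hr k).trans ?_
    have : lam ^ 2 / (192 * δ ^ 2) = z / 192 := by rw [hz]; field_simp
    rw [this]
    gcongr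
    exact hpe k
  have hqe' : ‖e - q‖ ≤ (1 - z / 8) * ‖e‖ := by
    have h4 : μ = (1 - z / 8) * (lam + μ) := by rw [hμ, hz]; field_simp; ring
    have h5 : (lam + μ) * ‖e - q‖ ≤ (lam + μ) * ((1 - z / 8) * ‖e‖) := by
      refine hqe.trans_eq ?_
      linear_combination ‖e‖ * h4
    exact le_of_mul_le_mul_left h5 hc
  have h12 : lam ^ 2 / (12 * δ ^ 2) = z / 12 := by rw [hz]; field_simp
  rw [hsplit, h12]
  have h1 := norm_add_le ((e - q) - (1 / (K : ℝ)) • ∑ k, (p k - q)) ((1 / (K : ℝ)) • ∑ k, r k)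
  have h2 := norm_sub_le (e - q) ((1 / (K : ℝ)) • ∑ k, (p k - q))
  -- Budget in units of `z`: -1/8 + 1/40 + (9/4)/192 ≤ -1/12.
  nlinarith [norm_nonneg e, mul_nonneg hz0 (norm_nonneg e)]

end Contraction

/-! ### Quadratic functions and stationarity of the subproblems. -/

section Quadratic

variable {d : ℕ}

lemma inner_toEuclideanCLM_comm {H : Matrix (Fin d) (Fin d) ℝ} (hH : H.IsHermitian)
    (x y : EuclideanSpace ℝ (Fin d)) :
    ⟪Matrix.toEuclideanCLM (𝕜 := ℝ) H x, y⟫ = ⟪x, Matrix.toEuclideanCLM (𝕜 := ℝ) H y⟫ :=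
  Matrix.isSymmetric_toEuclideanLin_iff.2 hH x y

lemma inner_toEuclideanCLM_nonneg {H : Matrix (Fin d) (Fin d) ℝ} (hH : H.PosSemidef)
    (x : EuclideanSpace ℝ (Fin d)) : 0 ≤ ⟪x, Matrix.toEuclideanCLM (𝕜 := ℝ) H x⟫ := by
  rw [Matrix.inner_toEuclideanCLM]
  simpa using hH.dotProduct_mulVec_nonneg x.ofLp

lemma hasGradientAt_quad {H : Matrix (Fin d) (Fin d) ℝ} (hH : H.IsHermitian)
    (l v : EuclideanSpace ℝ (Fin d)) :
    HasGradientAt (quad H l) (Matrix.toEuclideanCLM (𝕜 := ℝ) H v + l) v := by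
  rw [hasGradientAt_iff_hasFDerivAt]
  have h1 := (hasFDerivAt_id (𝕜 := ℝ) v).inner ℝ
    (Matrix.toEuclideanCLM (𝕜 := ℝ) H).hasFDerivAt (x := v)
  have h2 := (hasFDerivAt_const (𝕜 := ℝ) l v).inner ℝ (hasFDerivAt_id v)
  refine ((h1.const_mul (1 / 2)).add h2).congr_fderiv ?_
  ext x
  have := inner_toEuclideanCLM_comm hH v x
  simp [fderivInnerCLM_apply]
  rw [← this, real_inner_comm x]
  ring

lemma toEuclideanCLM_add_eq_zero_of_isMinOn {H : Matrix (Fin d) (Fin d) ℝ} (hH : H.IsHermitian)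
    {l v : EuclideanSpace ℝ (Fin d)} (hv : IsMinOn (quad H l) Set.univ v) :
    Matrix.toEuclideanCLM (𝕜 := ℝ) H v + l = 0 := by
  have h1 := (hv.isLocalMin Filter.univ_mem).hasFDerivAt_eq_zero
    (hasGradientAt_iff_hasFDerivAt.1 (hasGradientAt_quad hH l v))
  exact (LinearEquiv.map_eq_zero_iff
    (InnerProductSpace.toDual ℝ (EuclideanSpace ℝ (Fin d))).toLinearEquiv).1 h1

lemma quad_sub_quad_of_stationary {H : Matrix (Fin d) (Fin d) ℝ} (hH : H.IsHermitian)
    {l v : EuclideanSpace ℝ (Fin d)} (hv : Matrix.toEuclideanCLM (𝕜 := ℝ) H v + l = 0)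
    (w : EuclideanSpace ℝ (Fin d)) :
    quad H l w = quad H l v + 1 / 2 * ⟪w - v, Matrix.toEuclideanCLM (𝕜 := ℝ) H (w - v)⟫ := by
  have hl : l = -Matrix.toEuclideanCLM (𝕜 := ℝ) H v := by
    rw [eq_neg_iff_add_eq_zero, add_comm]; exact hv
  have h1 := inner_toEuclideanCLM_comm hH v w
  have h2 := inner_toEuclideanCLM_comm hH v v
  have h3 := real_inner_comm w (Matrix.toEuclideanCLM (𝕜 := ℝ) H v)
  simp only [quad, hl, map_sub, inner_sub_left, inner_sub_right, inner_neg_left]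
  linarith

lemma avgFun_quad {K : ℕ} (H : Fin K → Matrix (Fin d) (Fin d) ℝ)
    (l : Fin K → EuclideanSpace ℝ (Fin d)) :
    avgFun (fun k => quad (H k) (l k)) = quad (avgMat H) ((1 / (K : ℝ)) • ∑ k, l k) := by
  ext w
  simp only [avgFun, quad, avgMat, map_smul, map_sum, smul_apply,
    sum_apply, inner_smul_left, inner_smul_right, inner_sum, sum_inner,
    Finset.sum_add_distrib, ← Finset.mul_sum]
  simp
  ring

/-- The gradient correction is linear and the proximal term quadratic, so the subproblem stays in
the class `quad` up to a constant that does not affect minimizers. -/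
lemma subproblem_quad {K : ℕ} (H : Fin K → Matrix (Fin d) (Fin d) ℝ)
    (l : Fin K → EuclideanSpace ℝ (Fin d)) (η μ : ℝ) (k : Fin K)
    (v w : EuclideanSpace ℝ (Fin d)) :
    subproblem (fun k => quad (H k) (l k)) η μ k v w =
      quad (H k + μ • 1) (l k - (∇ (quad (H k) (l k)) v -
        η • ∇ (avgFun fun k => quad (H k) (l k)) v) - μ • v) w + μ / 2 * ‖v‖ ^ 2 := by
  simp only [subproblem, quad, map_add, map_smul, map_one, add_apply, smul_apply,
    inner_add_right, inner_sub_left, inner_smul_left, inner_smul_right, norm_sub_sq_real]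
  simp [real_inner_comm]
  ring

lemma toEuclideanCLM_avgMat {K : ℕ} (H : Fin K → Matrix (Fin d) (Fin d) ℝ) :
    Matrix.toEuclideanCLM (𝕜 := ℝ) (avgMat H) =
      (1 / (K : ℝ)) • ∑ k, Matrix.toEuclideanCLM (𝕜 := ℝ) (H k) := by
  simp [avgMat]

lemma isHermitian_avgMat {K : ℕ} {H : Fin K → Matrix (Fin d) (Fin d) ℝ}
    (hH : ∀ k, (H k).IsHermitian) : (avgMat H).IsHermitian := by
  have h : (∑ k, H k).conjTranspose = ∑ k, H k := by
    rw [Matrix.conjTranspose_sum]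
    exact Finset.sum_congr rfl fun k _ => (hH k).eq
  rw [Matrix.IsHermitian, avgMat, Matrix.conjTranspose_smul, h, star_trivial]

/-- The stationarity equation of the local subproblem, written around the global minimizer. -/
lemma stationary_subproblem {K : ℕ} {H : Fin K → Matrix (Fin d) (Fin d) ℝ}
    (hH : ∀ k, (H k).IsHermitian) {l : Fin K → EuclideanSpace ℝ (Fin d)} {μ : ℝ} {k : Fin K}
    {v u what : EuclideanSpace ℝ (Fin d)}
    (hw : IsMinOn (avgFun fun k => quad (H k) (l k)) Set.univ what)
    (hu : IsMinOn (subproblem (fun k => quad (H k) (l k)) 1 μ k v) Set.univ u) :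
    Matrix.toEuclideanCLM (𝕜 := ℝ) (H k) (v - u) + μ • (v - u) =
      Matrix.toEuclideanCLM (𝕜 := ℝ) (avgMat H) (v - what) := by
  have hw' := hw
  rw [avgFun_quad] at hw'
  have h1 := toEuclideanCLM_add_eq_zero_of_isMinOn (isHermitian_avgMat hH) hw'
  have hu' : IsMinOn (quad (H k + μ • 1) (l k - (∇ (quad (H k) (l k)) v -
      (1 : ℝ) • ∇ (avgFun fun k => quad (H k) (l k)) v) - μ • v)) Set.univ u := by
    intro w hw
    have := hu hw
    simpa [subproblem_quad] using this
  have hsym : (H k + μ • (1 : Matrix (Fin d) (Fin d) ℝ)).IsHermitian := by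
    refine (hH k).add ?_
    simp [Matrix.IsHermitian]
  have h2 := toEuclideanCLM_add_eq_zero_of_isMinOn hsym hu'
  rw [avgFun_quad, (hasGradientAt_quad (hH k) _ _).gradient,
    (hasGradientAt_quad (isHermitian_avgMat hH) _ _).gradient] at h2
  simp only [map_add, map_smul, map_one, add_apply, smul_apply, one_smul,
    one_apply_eq_self] at h2
  rw [map_sub, map_sub, smul_sub]
  have h3 : (1 / (K : ℝ)) • ∑ k, l k = -Matrix.toEuclideanCLM (𝕜 := ℝ) (avgMat H) what := by
    rw [eq_neg_iff_add_eq_zero, add_comm]; exact h1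
  rw [h3] at h2
  rw [← sub_eq_zero, ← neg_eq_zero, ← h2]
  abel

end Quadratic

/-! ### From the one-round factor to the iteration count. -/

section Convergence

variable {K d : ℕ}

/-- The contraction factor of one round of InexactDANE with `η = 1`. -/
lemma exists_rate {lam δ : ℝ} (hK : 0 < K) {H : Fin K → Matrix (Fin d) (Fin d) ℝ}
    (hH : ∀ k, (H k).PosSemidef) (hδ : ∀ k k', specNorm (H k - H k') ≤ δ) (hδ0 : 0 ≤ δ)
    {l : Fin K → EuclideanSpace ℝ (Fin d)} (hlam : 0 < lam)
    (hl : (avgMat H - lam • (1 : Matrix (Fin d) (Fin d) ℝ)).PosSemidef)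
    {what w0 : EuclideanSpace ℝ (Fin d)} {w : ℕ → EuclideanSpace ℝ (Fin d)}
    (hw : IsMinOn (avgFun fun k => quad (H k) (l k)) Set.univ what)
    (hit : IsIterates (fun k => quad (H k) (l k)) 1 (muParam lam δ) (gammaParam lam δ) w0 w) :
    ∃ ρ : ℝ, 0 ≤ ρ ∧ (ρ ≤ 3 / 4 ∨ 0 < δ ∧ ρ ≤ 1 - lam ^ 2 / (12 * δ ^ 2)) ∧
      ∀ t, ‖w (t + 1) - what‖ ≤ ρ * ‖w t - what‖ := by
  set T : Fin K → EuclideanSpace ℝ (Fin d) →L[ℝ] EuclideanSpace ℝ (Fin d) :=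
    fun k => Matrix.toEuclideanCLM (𝕜 := ℝ) (H k) with hT
  set S := Matrix.toEuclideanCLM (𝕜 := ℝ) (avgMat H) with hSdef
  have havg : (1 / (K : ℝ)) • ∑ k, T k = S := (toEuclideanCLM_avgMat H).symm
  have hTS : ∀ k, ‖T k - S‖ ≤ δ := by
    intro k
    -- Writing the deviation from the mean as an average of pairwise differences loses no constant.
    have : T k - S = (1 / (K : ℝ)) • ∑ k', (T k - T k') := by
      rw [Finset.sum_sub_distrib, smul_sub, havg, average_const hK]
    rw [this]
    refine norm_average_le hK fun k' => ?_
    have := hδ k k'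
    rwa [specNorm, map_sub] at this
  have hS : ∀ x, lam * ‖x‖ ^ 2 ≤ ⟪x, S x⟫ := by
    intro x
    have := inner_toEuclideanCLM_nonneg hl x
    rw [map_sub, map_smul, map_one, sub_apply, inner_sub_right] at this
    simp only [smul_apply, one_apply_eq_self, inner_smul_right,
      real_inner_self_eq_norm_sq] at this
    linarith
  obtain ⟨-, hstep⟩ := hit
  have key : ∀ t, ∃ p r : Fin K → EuclideanSpace ℝ (Fin d),
      (∀ k, T k (p k) + muParam lam δ • p k = S (w t - what)) ∧
      (∀ k, ‖r k‖ ≤ gammaParam lam δ * ‖p k‖) ∧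
      w (t + 1) - what = (1 / (K : ℝ)) • ∑ k, ((w t - what) - p k + r k) := by
    intro t
    obtain ⟨u, hu, hwt⟩ := hstep t
    choose uh huh hur using hu
    refine ⟨fun k => w t - uh k, fun k => u k - uh k, fun k => ?_, fun k => hur k, ?_⟩
    · exact stationary_subproblem (fun k => (hH k).1) hw (huh k)
    · have : ∀ k, w t - what - (w t - uh k) + (u k - uh k) = u k - what := fun k => by abel
      simp_rw [this]
      rw [Finset.sum_sub_distrib, smul_sub, average_const hK, hwt]
  have h8 : (2 * √2 * δ) ^ 2 = 8 * δ ^ 2 := by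
    rw [mul_pow, mul_pow, Real.sq_sqrt (by norm_num)]; ring
  by_cases hc : 2 * √2 * δ ≤ lam
  · have hsq : 8 * δ ^ 2 ≤ lam ^ 2 := by
      rw [← h8]; gcongr
    have hμ : muParam lam δ = 0 := by
      rw [muParam, max_eq_left]
      rw [sub_nonpos, div_le_iff₀ hlam]
      linarith
    refine ⟨3 / 4, by norm_num, Or.inl le_rfl, fun t => ?_⟩
    obtain ⟨p, r, hp, hr, ht⟩ := key t
    rw [ht]
    simp only [gammaParam, hc, if_true] at hr
    exact norm_average_le_of_small hK hlam hsq hδ0 hS hTS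
      (fun k => by simpa [hμ] using hp k) hr
  · have hsq : lam ^ 2 < 8 * δ ^ 2 := by
      rw [← h8]
      push Not at hc
      gcongr
    have hδ1 : 0 < δ := by
      rcases hδ0.eq_or_lt with h | h
      · rw [← h] at hsq; nlinarith
      · exact h
    have hμ : muParam lam δ = 8 * δ ^ 2 / lam - lam := by
      rw [muParam, max_eq_right]
      rw [sub_nonneg, le_div_iff₀ hlam]
      linarith
    refine ⟨1 - lam ^ 2 / (12 * δ ^ 2), ?_, Or.inr ⟨hδ1, le_rfl⟩, fun t => ?_⟩
    · rw [sub_nonneg, div_le_one (by positivity)]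
      nlinarith
    obtain ⟨p, r, hp, hr, ht⟩ := key t
    rw [ht]
    simp only [gammaParam, hc, if_false] at hr
    exact norm_average_le_of_large hK hlam hsq hδ1 hμ hS
      (fun k => inner_toEuclideanCLM_nonneg (hH k)) havg hTS hp hr

lemma specNorm_avgMat_le (hK : 0 < K) {H : Fin K → Matrix (Fin d) (Fin d) ℝ} {L : ℝ}
    (hL : ∀ k, specNorm (H k) ≤ L) : specNorm (avgMat H) ≤ L := by
  rw [specNorm, toEuclideanCLM_avgMat]
  exact norm_average_le hK hL

/-- The iteration complexity of InexactDANE for quadratic functions with related Hessians. -/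
lemma avgFun_iterate_le {L lam δ R : ℝ} (hK : 0 < K) {H : Fin K → Matrix (Fin d) (Fin d) ℝ}
    (hH : ∀ k, (H k).PosSemidef) (hL : ∀ k, specNorm (H k) ≤ L)
    (hδ : ∀ k k', specNorm (H k - H k') ≤ δ) (hδ0 : 0 ≤ δ)
    {l : Fin K → EuclideanSpace ℝ (Fin d)} (hlam : 0 < lam) (hR1 : 1 ≤ R)
    (hR : δ ^ 2 ≤ 32 * lam ^ 2 * R)
    (hl : (avgMat H - lam • (1 : Matrix (Fin d) (Fin d) ℝ)).PosSemidef)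
    {what w0 : EuclideanSpace ℝ (Fin d)} {w : ℕ → EuclideanSpace ℝ (Fin d)}
    (hw : IsMinOn (avgFun fun k => quad (H k) (l k)) Set.univ what)
    (hit : IsIterates (fun k => quad (H k) (l k)) 1 (muParam lam δ) (gammaParam lam δ) w0 w)
    {ε : ℝ} (hε : 0 < ε) {t : ℕ} (ht : 192 * R * Real.log (L * ‖w0 - what‖ ^ 2 / ε) ≤ t) :
    avgFun (fun k => quad (H k) (l k)) (w t) ≤
      avgFun (fun k => quad (H k) (l k)) what + ε := by
  obtain ⟨ρ, hρ0, hρ, hstep⟩ := exists_rate hK hH hδ hδ0 hlam hl hw hit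
  have hρR : ρ ≤ 1 - 1 / (384 * R) := by
    rcases hρ with h | ⟨hδ1, h⟩
    · have : 1 / (384 * R) ≤ 1 / 4 := by
        apply one_div_le_one_div_of_le <;> linarith
      linarith
    · have : 1 / (384 * R) ≤ lam ^ 2 / (12 * δ ^ 2) := by
        rw [div_le_div_iff₀ (by positivity) (by positivity)]
        linarith
      linarith
  have hρe : ρ ≤ Real.exp (-(1 / (384 * R))) :=
    hρR.trans (by linarith [Real.add_one_le_exp (-(1 / (384 * R)))])
  have hnorm : ∀ s : ℕ, ‖w s - what‖ ≤ ρ ^ s * ‖w0 - what‖ := by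
    intro s
    induction s with
    | zero => simp [hit.1]
    | succ s ih =>
      calc ‖w (s + 1) - what‖ ≤ ρ * ‖w s - what‖ := hstep s
        _ ≤ ρ * (ρ ^ s * ‖w0 - what‖) := by gcongr
        _ = _ := by ring
  have hLS := specNorm_avgMat_le hK hL
  have hL0 : 0 ≤ L := (norm_nonneg _).trans hLS
  rw [avgFun_quad] at hw ⊢
  have hsym := isHermitian_avgMat fun k => (hH k).1
  rw [quad_sub_quad_of_stationary hsym (toEuclideanCLM_add_eq_zero_of_isMinOn hsym hw)]
  have h1 : ⟪w t - what, Matrix.toEuclideanCLM (𝕜 := ℝ) (avgMat H) (w t - what)⟫ ≤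
      L * ‖w t - what‖ ^ 2 := by
    refine (real_inner_le_norm _ _).trans ?_
    have := (Matrix.toEuclideanCLM (𝕜 := ℝ) (avgMat H)).le_of_opNorm_le hLS (w t - what)
    nlinarith [norm_nonneg (w t - what)]
  have h2 : L * ‖w t - what‖ ^ 2 ≤ ε := by
    have h3 : ‖w t - what‖ ≤ Real.exp (-(1 / (384 * R))) ^ t * ‖w0 - what‖ :=
      (hnorm t).trans (by gcongr)
    have h4 : L * ‖w t - what‖ ^ 2 ≤
        Real.exp (-(t / (192 * R))) * (L * ‖w0 - what‖ ^ 2) := by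
      calc L * ‖w t - what‖ ^ 2
          ≤ L * (Real.exp (-(1 / (384 * R))) ^ t * ‖w0 - what‖) ^ 2 := by gcongr
        _ = Real.exp (-(t / (192 * R))) * (L * ‖w0 - what‖ ^ 2) := by
            -- Squaring the distance halves 384 = 12 · 32 to 192.
            have : Real.exp (-(t / (192 * R))) = (Real.exp (-(1 / (384 * R))) ^ t) ^ 2 := by
              rw [← Real.exp_nat_mul, ← Real.exp_nat_mul]
              congr 1
              push_cast
              field_simp
              ring
            rw [this]; ring
    refine h4.trans ?_
    -- If the initial quantity is zero, the logarithm says nothing (`Real.log 0 = 0`), but the bound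
    -- is then trivial for every `t`.
    rcases (show 0 ≤ L * ‖w0 - what‖ ^ 2 by positivity).eq_or_lt with h0 | h0
    · rw [← h0]; simpa using hε.le
    · have h5 : Real.log (L * ‖w0 - what‖ ^ 2 / ε) ≤ t / (192 * R) := by
        rw [le_div_iff₀ (by positivity)]; linarith
      have h6 : L * ‖w0 - what‖ ^ 2 / ε ≤ Real.exp (t / (192 * R)) :=
        (Real.log_le_iff_le_exp (by positivity)).1 h5
      rw [div_le_iff₀ hε] at h6
      calc _ ≤ Real.exp (-(t / (192 * R))) * (Real.exp (t / (192 * R)) * ε) := by gcongr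
        _ = ε := by rw [← mul_assoc, ← Real.exp_add]; simp
  linarith

end Convergence

/-! ### A two-sided second-order bound for the scalar exponential. -/

section ScalarExp

/-- For x ≤ 0, use exp(-x) ≥ 1 - x + x²/2 and (1 + x + x²/2)(1 - x + x²/2) = 1 + x⁴/4 ≥ 1. For x ≥
0, multiply by exp(-x): the function `g` equals 1 at 0 and is increasing because y exp(-y) ≤ 1. -/
lemma exp_le_quadratic (x : ℝ) :
    Real.exp x ≤ 1 + x + x ^ 2 * (1 / 2 + Real.exp x / 4) := by
  rcases le_total x 0 with hx | hx
  · have h1 := Real.quadratic_le_exp_of_nonneg (neg_nonneg.2 hx)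
    have h2 : Real.exp x * Real.exp (-x) = 1 := by rw [← Real.exp_add]; simp
    have h3 := Real.exp_pos x
    have h4 : Real.exp x * (1 - x + x ^ 2 / 2) ≤ 1 := by nlinarith
    have h5 : 0 < 1 - x + x ^ 2 / 2 := by nlinarith
    have h6 : Real.exp x * (1 - x + x ^ 2 / 2) ≤
        (1 + x + x ^ 2 / 2) * (1 - x + x ^ 2 / 2) := by
      nlinarith [sq_nonneg (x ^ 2)]
    have h7 := le_of_mul_le_mul_right h6 h5
    nlinarith [mul_nonneg (sq_nonneg x) h3.le]
  · let g : ℝ → ℝ := fun y => (1 + y + y ^ 2 / 2) * Real.exp (-y) + y ^ 2 / 4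
    have hg : ∀ y, HasDerivAt g (y / 2 * (1 - y * Real.exp (-y))) y := by
      intro y
      have h1 : HasDerivAt (fun y : ℝ => 1 + y + y ^ 2 / 2) (1 + y) y := by
        have := ((hasDerivAt_id y).const_add 1).add ((hasDerivAt_pow 2 y).div_const 2)
        refine this.congr_deriv ?_
        simp
      have h2 : HasDerivAt (fun y : ℝ => Real.exp (-y)) (-Real.exp (-y)) y := by
        simpa using (hasDerivAt_neg y).exp
      refine ((h1.mul h2).add ((hasDerivAt_pow 2 y).div_const 4)).congr_deriv ?_
      simp
      ring
    have hmono : MonotoneOn g (Set.Ici 0) := by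
      refine monotoneOn_of_deriv_nonneg (convex_Ici 0)
        (fun y _ => (hg y).continuousAt.continuousWithinAt)
        (fun y _ => (hg y).differentiableAt.differentiableWithinAt) fun y hy => ?_
      rw [interior_Ici] at hy
      rw [(hg y).deriv]
      have hy' : (0 : ℝ) < y := hy
      have h1 : y * Real.exp (-y) ≤ 1 := by
        have h2 : Real.exp y * Real.exp (-y) = 1 := by rw [← Real.exp_add]; simp
        have h3 := Real.add_one_le_exp y
        have h4 := Real.exp_pos (-y)
        nlinarith
      have : 0 ≤ 1 - y * Real.exp (-y) := by linarith
      positivity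
    have h1 := hmono (Set.mem_Ici.2 le_rfl) (Set.mem_Ici.2 hx) hx
    simp only [g] at h1
    have h2 : Real.exp x * Real.exp (-x) = 1 := by rw [← Real.exp_add]; simp
    have h3 := mul_le_mul_of_nonneg_left h1 (Real.exp_pos x).le
    have h4 : Real.exp x * ((1 + x + x ^ 2 / 2) * Real.exp (-x) + x ^ 2 / 4) =
        (1 + x + x ^ 2 / 2) + x ^ 2 * Real.exp x / 4 := by
      linear_combination (1 + x + x ^ 2 / 2) * h2
    rw [h4] at h3
    simp at h3
    linarith

/-- The remainder splits into a part weighted by exp a and a part weighted by exp b, with no mixed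
exponential. This lets a sum over pairs of eigenvalues be carried out in one index at a time. -/
lemma exp_le_exp_add (a b : ℝ) :
    Real.exp b ≤ Real.exp a + (b - a) * Real.exp a +
      (b - a) ^ 2 * (Real.exp a / 2 + Real.exp b / 4) := by
  have h1 := mul_le_mul_of_nonneg_left (exp_le_quadratic (b - a)) (Real.exp_pos a).le
  have h2 : Real.exp a * Real.exp (b - a) = Real.exp b := by rw [← Real.exp_add]; simp
  have h3 : Real.exp a * (1 + (b - a) + (b - a) ^ 2 * (1 / 2 + Real.exp (b - a) / 4)) =
      Real.exp a + (b - a) * Real.exp a +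
      (b - a) ^ 2 * (Real.exp a / 2 + Real.exp b / 4) := by
    rw [← h2]; ring
  linarith

end ScalarExp

/-! ### Spectral calculus and the trace exponential. -/

section MatrixExp

variable {d : ℕ}

open Matrix in
lemma toEuclideanCLM_eigenvectorBasis {M : Matrix (Fin d) (Fin d) ℝ} (hM : M.IsHermitian)
    (i : Fin d) : toEuclideanCLM (𝕜 := ℝ) M (hM.eigenvectorBasis i) =
      hM.eigenvalues i • hM.eigenvectorBasis i := by
  apply (WithLp.ofLp_injective 2)
  rw [ofLp_toEuclideanCLM, hM.mulVec_eigenvectorBasis]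
  rfl

open Matrix in
lemma toEuclideanCLM_exp_eigenvectorBasis {M : Matrix (Fin d) (Fin d) ℝ} (hM : M.IsHermitian)
    (i : Fin d) : toEuclideanCLM (𝕜 := ℝ) (NormedSpace.exp M) (hM.eigenvectorBasis i) =
      Real.exp (hM.eigenvalues i) • hM.eigenvectorBasis i := by
  apply (WithLp.ofLp_injective 2)
  rw [ofLp_toEuclideanCLM]
  set U : Matrix (Fin d) (Fin d) ℝ := hM.eigenvectorUnitary.1 with hU
  have hUs : U * star U = 1 := Unitary.coe_mul_star_self hM.eigenvectorUnitary
  have hinv : U⁻¹ = star U := Matrix.inv_eq_right_inv hUs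
  have hunit : IsUnit U := IsUnit.of_mul_eq_one _ hUs
  have hspec : M = U * diagonal hM.eigenvalues * U⁻¹ := by
    rw [hinv]
    conv_lhs => rw [hM.spectral_theorem, Unitary.conjStarAlgAut_apply]
    rfl
  have hexp : NormedSpace.exp M = U * diagonal (fun j => Real.exp (hM.eigenvalues j)) * star U := by
    conv_lhs => rw [hspec, Matrix.exp_conj _ _ hunit, Matrix.exp_diagonal, hinv]
    congr 3
    ext j
    rw [Pi.coe_exp, Real.exp_eq_exp_ℝ]
  rw [hexp, ← mulVec_mulVec, ← mulVec_mulVec, hU, hM.star_eigenvectorUnitary_mulVec,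
    diagonal_mulVec_single, mul_one]
  have : Pi.single (M := fun _ : Fin d => ℝ) i (Real.exp (hM.eigenvalues i)) =
      Real.exp (hM.eigenvalues i) • Pi.single i 1 := by
    rw [← Pi.single_smul]; simp
  rw [this, mulVec_smul, hM.eigenvectorUnitary_mulVec]
  rfl

lemma trace_eq_sum_inner (M : Matrix (Fin d) (Fin d) ℝ)
    (b : OrthonormalBasis (Fin d) ℝ (EuclideanSpace ℝ (Fin d))) :
    M.trace = ∑ i, ⟪b i, Matrix.toEuclideanCLM (𝕜 := ℝ) M (b i)⟫ := by
  rw [← Matrix.trace_toLin_eq M (PiLp.basisFun 2 ℝ (Fin d)), ← Matrix.toLpLin_eq_toLin]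
  exact LinearMap.trace_eq_sum_inner _ b

lemma inner_eigenvectorBasis_toEuclideanCLM {M : Matrix (Fin d) (Fin d) ℝ} (hM : M.IsHermitian)
    (i : Fin d) (x : EuclideanSpace ℝ (Fin d)) :
    ⟪hM.eigenvectorBasis i, Matrix.toEuclideanCLM (𝕜 := ℝ) M x⟫ =
      hM.eigenvalues i * ⟪hM.eigenvectorBasis i, x⟫ := by
  rw [← inner_toEuclideanCLM_comm hM, toEuclideanCLM_eigenvectorBasis, inner_smul_left]
  rfl

lemma inner_toEuclideanCLM_self_eq_sum {M : Matrix (Fin d) (Fin d) ℝ} (hM : M.IsHermitian)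
    (x : EuclideanSpace ℝ (Fin d)) :
    ⟪x, Matrix.toEuclideanCLM (𝕜 := ℝ) M x⟫ =
      ∑ i, hM.eigenvalues i * ⟪hM.eigenvectorBasis i, x⟫ ^ 2 := by
  rw [← hM.eigenvectorBasis.sum_inner_mul_inner]
  refine Finset.sum_congr rfl fun i _ => ?_
  rw [inner_eigenvectorBasis_toEuclideanCLM, real_inner_comm]
  ring

lemma sum_inner_eigenvectorBasis_sq {M : Matrix (Fin d) (Fin d) ℝ} (hM : M.IsHermitian)
    (x : EuclideanSpace ℝ (Fin d)) : ∑ i, ⟪hM.eigenvectorBasis i, x⟫ ^ 2 = ‖x‖ ^ 2 := by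
  simpa using hM.eigenvectorBasis.sum_sq_norm_inner_right x

/-- Testing the form on eigenvectors bounds the eigenvalues; Parseval in the eigenbasis then bounds
the norm. -/
lemma specNorm_le_of_abs_inner_le {M : Matrix (Fin d) (Fin d) ℝ} (hM : M.IsHermitian) {t : ℝ}
    (ht : 0 ≤ t) (h : ∀ x, |⟪x, Matrix.toEuclideanCLM (𝕜 := ℝ) M x⟫| ≤ t * ‖x‖ ^ 2) :
    specNorm M ≤ t := by
  have hev : ∀ i, hM.eigenvalues i ^ 2 ≤ t ^ 2 := by
    intro i
    have := h (hM.eigenvectorBasis i)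
    rw [inner_eigenvectorBasis_toEuclideanCLM, real_inner_self_eq_norm_sq,
      hM.eigenvectorBasis.norm_eq_one] at this
    simp only [one_pow, mul_one] at this
    exact sq_le_sq' (abs_le.1 this).1 (abs_le.1 this).2
  refine ContinuousLinearMap.opNorm_le_bound _ ht fun x => ?_
  refine (sq_le_sq₀ (norm_nonneg _) (by positivity)).1 ?_
  rw [← sum_inner_eigenvectorBasis_sq hM, mul_pow, ← sum_inner_eigenvectorBasis_sq hM x,
    Finset.mul_sum]
  refine Finset.sum_le_sum fun i _ => ?_
  rw [inner_eigenvectorBasis_toEuclideanCLM, mul_pow]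
  exact mul_le_mul_of_nonneg_right (hev i) (sq_nonneg _)

lemma trace_exp {M : Matrix (Fin d) (Fin d) ℝ} (hM : M.IsHermitian) :
    (NormedSpace.exp M).trace = ∑ i, Real.exp (hM.eigenvalues i) := by
  rw [trace_eq_sum_inner _ hM.eigenvectorBasis]
  refine Finset.sum_congr rfl fun i _ => ?_
  rw [toEuclideanCLM_exp_eigenvectorBasis, inner_smul_right, real_inner_self_eq_norm_sq,
    hM.eigenvectorBasis.norm_eq_one]
  simp

lemma trace_exp_nonneg {M : Matrix (Fin d) (Fin d) ℝ} (hM : M.IsHermitian) :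
    0 ≤ (NormedSpace.exp M).trace := by
  rw [trace_exp hM]
  exact Finset.sum_nonneg fun i _ => (Real.exp_pos _).le

lemma exp_le_trace_exp {M : Matrix (Fin d) (Fin d) ℝ} (hM : M.IsHermitian) {s : ℝ}
    {x : EuclideanSpace ℝ (Fin d)}
    (hx : s * ‖x‖ ^ 2 < ⟪x, Matrix.toEuclideanCLM (𝕜 := ℝ) M x⟫) :
    Real.exp s ≤ (NormedSpace.exp M).trace := by
  obtain ⟨i, hi⟩ : ∃ i, s ≤ hM.eigenvalues i := by
    by_contra! h
    refine hx.not_ge ?_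
    rw [inner_toEuclideanCLM_self_eq_sum hM, ← sum_inner_eigenvectorBasis_sq hM x, Finset.mul_sum]
    exact Finset.sum_le_sum fun i _ => mul_le_mul_of_nonneg_right (h i).le (sq_nonneg _)
  rw [trace_exp hM]
  exact (Real.exp_le_exp.2 hi).trans
    (Finset.single_le_sum (f := fun i => Real.exp (hM.eigenvalues i))
      (fun j _ => (Real.exp_pos _).le) (Finset.mem_univ i))

/-- A large norm forces a large value of the quadratic form of `M` or of `-M`, which the
corresponding trace detects. -/
lemma exp_le_trace_exp_add_trace_exp_neg {M : Matrix (Fin d) (Fin d) ℝ} (hM : M.IsHermitian)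
    {s : ℝ} (hs : 0 ≤ s) (h : s < specNorm M) :
    Real.exp s ≤ (NormedSpace.exp M).trace + (NormedSpace.exp (-M)).trace := by
  have h0 := trace_exp_nonneg hM
  have h0' := trace_exp_nonneg hM.neg
  by_contra! hlt
  refine h.not_ge (specNorm_le_of_abs_inner_le hM hs fun x => abs_le.2 ⟨?_, ?_⟩)
  · by_contra! hx
    have : Real.exp s ≤ (NormedSpace.exp (-M)).trace := by
      refine exp_le_trace_exp hM.neg (x := x) ?_
      rw [map_neg, neg_apply, inner_neg_right]
      linarith
    linarith
  · by_contra! hx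
    have := exp_le_trace_exp hM hx
    linarith

/-- A second order expansion of the trace exponential. -/
lemma trace_exp_le {A B : Matrix (Fin d) (Fin d) ℝ} (hA : A.IsHermitian) (hB : B.IsHermitian)
    {r : ℝ} (hr : specNorm (B - A) ≤ r) :
    (1 - r ^ 2 / 4) * (NormedSpace.exp B).trace ≤
      (1 + r ^ 2 / 2) * (NormedSpace.exp A).trace + ((B - A) * NormedSpace.exp A).trace := by
  set a := hA.eigenvectorBasis with ha
  set b := hB.eigenvectorBasis with hb
  set α := hA.eigenvalues with hα
  set β := hB.eigenvalues with hβ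
  -- Squared overlaps of the two eigenbases form a doubly stochastic matrix. Against it, all the
  -- traces become sums over pairs of eigenvalues, so the scalar inequality applies termwise.
  set W : Fin d → Fin d → ℝ := fun i j => ⟪b j, a i⟫ ^ 2 with hW
  have hrow : ∀ i, ∑ j, W i j = 1 := fun i => by
    simp only [hW, hb]
    rw [sum_inner_eigenvectorBasis_sq hB, ha, hA.eigenvectorBasis.norm_eq_one, one_pow]
  have hcol : ∀ j, ∑ i, W i j = 1 := fun j => by
    simp only [hW, ha, real_inner_comm (hA.eigenvectorBasis _)]
    rw [sum_inner_eigenvectorBasis_sq hA, hb, hB.eigenvectorBasis.norm_eq_one, one_pow]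
  have htA : (NormedSpace.exp A).trace = ∑ i, ∑ j, W i j * Real.exp (α i) := by
    simp_rw [← Finset.sum_mul, hrow, one_mul]
    exact trace_exp hA
  have htB : (NormedSpace.exp B).trace = ∑ i, ∑ j, W i j * Real.exp (β j) := by
    rw [Finset.sum_comm]
    simp_rw [← Finset.sum_mul, hcol, one_mul]
    exact trace_exp hB
  have htX : ((B - A) * NormedSpace.exp A).trace =
      ∑ i, ∑ j, W i j * ((β j - α i) * Real.exp (α i)) := by
    rw [trace_eq_sum_inner _ a]
    refine Finset.sum_congr rfl fun i _ => ?_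
    rw [map_mul, mul_apply_eq_comp, ha, toEuclideanCLM_exp_eigenvectorBasis, map_smul,
      inner_smul_right, map_sub, sub_apply, inner_sub_right, inner_toEuclideanCLM_self_eq_sum hB,
      inner_eigenvectorBasis_toEuclideanCLM, real_inner_self_eq_norm_sq,
      hA.eigenvectorBasis.norm_eq_one]
    have h1 : ∑ j, W i j * ((β j - α i) * Real.exp (α i)) =
        Real.exp (α i) * (∑ j, β j * W i j - α i * ∑ j, W i j) := by
      rw [Finset.mul_sum, ← Finset.sum_sub_distrib, Finset.mul_sum]
      exact Finset.sum_congr rfl fun j _ => by ring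
    rw [h1, hrow]
    simp [hW, hα, hβ, ha, hb]
  -- The weighted squared gaps are squared matrix entries of `B - A` between the two bases, so their
  -- row and column sums are at most `r²`.
  have hdiff : ∀ i j, ⟪b j, Matrix.toEuclideanCLM (𝕜 := ℝ) (B - A) (a i)⟫ ^ 2 =
      (β j - α i) ^ 2 * W i j := by
    intro i j
    rw [map_sub, sub_apply, inner_sub_right, ha, hb, inner_eigenvectorBasis_toEuclideanCLM,
      toEuclideanCLM_eigenvectorBasis, inner_smul_right]
    simp only [hW]
    ring
  have hnorm : ∀ x : EuclideanSpace ℝ (Fin d), ‖x‖ = 1 →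
      ‖Matrix.toEuclideanCLM (𝕜 := ℝ) (B - A) x‖ ^ 2 ≤ r ^ 2 := by
    intro x hx
    have := (Matrix.toEuclideanCLM (𝕜 := ℝ) (B - A)).le_of_opNorm_le hr x
    rw [hx, mul_one] at this
    gcongr
  have hrow2 : ∀ i, ∑ j, (β j - α i) ^ 2 * W i j ≤ r ^ 2 := by
    intro i
    simp_rw [← hdiff]
    rw [hb, sum_inner_eigenvectorBasis_sq hB]
    exact hnorm _ (hA.eigenvectorBasis.norm_eq_one i)
  have hcol2 : ∀ j, ∑ i, (β j - α i) ^ 2 * W i j ≤ r ^ 2 := by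
    intro j
    have hsymm : ∀ i, (β j - α i) ^ 2 * W i j =
        ⟪a i, Matrix.toEuclideanCLM (𝕜 := ℝ) (B - A) (b j)⟫ ^ 2 := by
      intro i
      rw [← hdiff, ← inner_toEuclideanCLM_comm (hB.sub hA), real_inner_comm]
    simp_rw [hsymm]
    rw [ha, sum_inner_eigenvectorBasis_sq hA]
    exact hnorm _ (hB.eigenvectorBasis.norm_eq_one j)
  have hquadA : ∑ i, ∑ j, W i j * ((β j - α i) ^ 2 * (Real.exp (α i) / 2)) ≤
      r ^ 2 / 2 * (NormedSpace.exp A).trace := by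
    rw [trace_exp hA, Finset.mul_sum]
    refine Finset.sum_le_sum fun i _ => ?_
    calc ∑ j, W i j * ((β j - α i) ^ 2 * (Real.exp (α i) / 2)) =
          (∑ j, (β j - α i) ^ 2 * W i j) * (Real.exp (α i) / 2) := by
          rw [Finset.sum_mul]
          exact Finset.sum_congr rfl fun j _ => by ring
      _ ≤ r ^ 2 * (Real.exp (α i) / 2) := by gcongr; exact hrow2 i
      _ = _ := by ring
  have hquadB : ∑ i, ∑ j, W i j * ((β j - α i) ^ 2 * (Real.exp (β j) / 4)) ≤
      r ^ 2 / 4 * (NormedSpace.exp B).trace := by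
    rw [trace_exp hB, Finset.mul_sum, Finset.sum_comm]
    refine Finset.sum_le_sum fun j _ => ?_
    calc ∑ i, W i j * ((β j - α i) ^ 2 * (Real.exp (β j) / 4)) =
          (∑ i, (β j - α i) ^ 2 * W i j) * (Real.exp (β j) / 4) := by
          rw [Finset.sum_mul]
          exact Finset.sum_congr rfl fun j _ => by ring
      _ ≤ r ^ 2 * (Real.exp (β j) / 4) := by gcongr; exact hcol2 j
      _ = _ := by ring
  have hsum : (NormedSpace.exp B).trace ≤ (NormedSpace.exp A).trace +
      ((B - A) * NormedSpace.exp A).trace +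
      (∑ i, ∑ j, W i j * ((β j - α i) ^ 2 * (Real.exp (α i) / 2)) +
        ∑ i, ∑ j, W i j * ((β j - α i) ^ 2 * (Real.exp (β j) / 4))) := by
    rw [htA, htB, htX]
    simp_rw [← Finset.sum_add_distrib]
    refine Finset.sum_le_sum fun i _ => Finset.sum_le_sum fun j _ => ?_
    have := mul_le_mul_of_nonneg_left (exp_le_exp_add (α i) (β j)) (sq_nonneg ⟪b j, a i⟫)
    simp only [hW]
    linarith
  linarith

end MatrixExp

/-! ### Measurability and norm bounds for matrices. -/

section MatrixBorel

variable {d : ℕ}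

instance matrixBorelSpace : BorelSpace (Matrix (Fin d) (Fin d) ℝ) :=
  inferInstanceAs (BorelSpace (Fin d → Fin d → ℝ))

instance matrixSecondCountable : SecondCountableTopology (Matrix (Fin d) (Fin d) ℝ) :=
  inferInstanceAs (SecondCountableTopology (Fin d → Fin d → ℝ))

instance matrixMeasurableAdd : MeasurableAdd₂ (Matrix (Fin d) (Fin d) ℝ) :=
  ⟨continuous_add.measurable⟩

lemma continuous_exp :
    Continuous (NormedSpace.exp : Matrix (Fin d) (Fin d) ℝ → Matrix (Fin d) (Fin d) ℝ) := by
  -- The norm is opened only for this proof; the statement concerns the entrywise topology.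
  open scoped Matrix.Norms.Operator in exact NormedSpace.exp_continuous

lemma measurable_entry (a b : Fin d) :
    Measurable fun M : Matrix (Fin d) (Fin d) ℝ => M a b :=
  (continuous_id.matrix_elem a b).measurable

lemma abs_entry_le_specNorm (M : Matrix (Fin d) (Fin d) ℝ) (a b : Fin d) :
    |M a b| ≤ specNorm M := by
  have h1 : M a b = ⟪EuclideanSpace.single a (1 : ℝ),
      Matrix.toEuclideanCLM (𝕜 := ℝ) M (EuclideanSpace.single b (1 : ℝ))⟫ := by
    rw [Matrix.inner_toEuclideanCLM]
    simp
  rw [h1]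
  refine (abs_real_inner_le_norm _ _).trans ?_
  have := (Matrix.toEuclideanCLM (𝕜 := ℝ) M).le_opNorm (EuclideanSpace.single b (1 : ℝ))
  simpa [specNorm] using this

lemma specNorm_exp_le {M : Matrix (Fin d) (Fin d) ℝ} (hM : M.IsHermitian) :
    specNorm (NormedSpace.exp M) ≤ Real.exp (specNorm M) := by
  refine specNorm_le_of_abs_inner_le hM.exp (Real.exp_pos _).le fun x => ?_
  have hev : ∀ i, hM.eigenvalues i ≤ specNorm M := by
    intro i
    have h1 := (Matrix.toEuclideanCLM (𝕜 := ℝ) M).le_opNorm (hM.eigenvectorBasis i)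
    rw [toEuclideanCLM_eigenvectorBasis, norm_smul, hM.eigenvectorBasis.norm_eq_one] at h1
    simp only [mul_one] at h1
    exact (le_abs_self _).trans h1
  have h2 : ⟪x, Matrix.toEuclideanCLM (𝕜 := ℝ) (NormedSpace.exp M) x⟫ =
      ∑ i, Real.exp (hM.eigenvalues i) * ⟪hM.eigenvectorBasis i, x⟫ ^ 2 := by
    rw [← hM.eigenvectorBasis.sum_inner_mul_inner]
    refine Finset.sum_congr rfl fun i _ => ?_
    rw [← inner_toEuclideanCLM_comm hM.exp, toEuclideanCLM_exp_eigenvectorBasis, inner_smul_left,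
      real_inner_comm]
    simp
    ring
  rw [h2, abs_of_nonneg (Finset.sum_nonneg fun i _ => by positivity),
    ← sum_inner_eigenvectorBasis_sq hM x, Finset.mul_sum]
  refine Finset.sum_le_sum fun i _ => ?_
  gcongr
  exact hev i

lemma specNorm_add_le (M N : Matrix (Fin d) (Fin d) ℝ) :
    specNorm (M + N) ≤ specNorm M + specNorm N := by
  simp only [specNorm, map_add]
  exact norm_add_le _ _

lemma specNorm_smul (c : ℝ) (M : Matrix (Fin d) (Fin d) ℝ) :
    specNorm (c • M) = |c| * specNorm M := by
  rw [specNorm, map_smul, norm_smul, Real.norm_eq_abs, specNorm]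

lemma specNorm_sum_le {ι : Type*} (s : Finset ι) {X : ι → Matrix (Fin d) (Fin d) ℝ} {r : ℝ}
    (h : ∀ i ∈ s, specNorm (X i) ≤ r) : specNorm (∑ i ∈ s, X i) ≤ s.card * r := by
  rw [specNorm, map_sum]
  exact (norm_sum_le_of_le s h).trans (by simp)

lemma isHermitian_sum {ι : Type*} (s : Finset ι) {X : ι → Matrix (Fin d) (Fin d) ℝ}
    (h : ∀ i ∈ s, (X i).IsHermitian) : (∑ i ∈ s, X i).IsHermitian := by
  rw [Matrix.IsHermitian, Matrix.conjTranspose_sum]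
  exact Finset.sum_congr rfl fun i hi => h i hi

end MatrixBorel

/-! ### Matrix Hoeffding inequality. -/

section MatrixHoeffding

variable {d : ℕ} {Ω : Type*} [MeasurableSpace Ω] {P : Measure Ω} [IsProbabilityMeasure P]

lemma integrable_entry {Y : Ω → Matrix (Fin d) (Fin d) ℝ} (hY : Measurable Y) {r : ℝ}
    (hr : ∀ᵐ ω ∂P, specNorm (Y ω) ≤ r) (a b : Fin d) : Integrable (fun ω => Y ω a b) P := by
  refine Integrable.of_bound ((measurable_entry a b).comp hY).aestronglyMeasurable r ?_
  filter_upwards [hr] with ω hω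
  exact (abs_entry_le_specNorm _ a b).trans hω

lemma integrable_trace {Y : Ω → Matrix (Fin d) (Fin d) ℝ} (hY : Measurable Y) {r : ℝ}
    (hr : ∀ᵐ ω ∂P, specNorm (Y ω) ≤ r) : Integrable (fun ω => (Y ω).trace) P :=
  integrable_finsetSum _ fun a _ => integrable_entry hY hr a a

lemma integrable_trace_exp {Y : Ω → Matrix (Fin d) (Fin d) ℝ} (hY : Measurable Y) {r : ℝ}
    (hh : ∀ᵐ ω ∂P, (Y ω).IsHermitian) (hr : ∀ᵐ ω ∂P, specNorm (Y ω) ≤ r) :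
    Integrable (fun ω => (NormedSpace.exp (Y ω)).trace) P := by
  refine integrable_trace (continuous_exp.measurable.comp hY) (r := Real.exp r) ?_
  filter_upwards [hh, hr] with ω h1 h2
  exact (specNorm_exp_le h1).trans (Real.exp_le_exp.2 h2)

/-- A centred bounded matrix contributes nothing to first order. -/
lemma integral_trace_mul_eq_zero {X Y : Ω → Matrix (Fin d) (Fin d) ℝ} (hX : Measurable X)
    (hY : Measurable Y) (hXY : X ⟂ᵢ[P] Y) {r s : ℝ} (hr : ∀ᵐ ω ∂P, specNorm (X ω) ≤ r)
    (hs : ∀ᵐ ω ∂P, specNorm (Y ω) ≤ s) (h0 : ∀ a b, ∫ ω, X ω a b ∂P = 0) :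
    Integrable (fun ω => (X ω * Y ω).trace) P ∧ ∫ ω, (X ω * Y ω).trace ∂P = 0 := by
  have hind : ∀ a b, (fun ω => X ω a b) ⟂ᵢ[P] (fun ω => Y ω b a) := fun a b =>
    hXY.comp (measurable_entry a b) (measurable_entry b a)
  have hint : ∀ a b, Integrable (fun ω => X ω a b * Y ω b a) P := fun a b =>
    (hind a b).integrable_mul (integrable_entry hX hr a b) (integrable_entry hY hs b a)
  have heq : (fun ω => (X ω * Y ω).trace) = fun ω => ∑ a, ∑ b, X ω a b * Y ω b a := by
    ext ω
    simp [Matrix.trace, Matrix.mul_apply]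
  rw [heq]
  refine ⟨integrable_finsetSum _ fun a _ => integrable_finsetSum _ fun b _ => hint a b, ?_⟩
  rw [integral_finsetSum _ fun a _ => integrable_finsetSum _ fun b _ => hint a b]
  refine Finset.sum_eq_zero fun a _ => ?_
  rw [integral_finsetSum _ fun b _ => hint a b]
  refine Finset.sum_eq_zero fun b _ => ?_
  rw [(hind a b).integral_fun_mul_eq_mul_integral (integrable_entry hX hr a b).1
    (integrable_entry hY hs b a).1, h0, zero_mul]

/-- The trace moment generating function of a sum of independent centred bounded matrices. -/
lemma integral_trace_exp_sum_le {ι : Type*} {X : ι → Ω → Matrix (Fin d) (Fin d) ℝ}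
    (hX : ∀ i, Measurable (X i)) (hind : iIndepFun X P)
    (hh : ∀ i, ∀ᵐ ω ∂P, (X i ω).IsHermitian) {r : ℝ} (hr0 : 0 ≤ r) (hr1 : r ≤ 1)
    (hr : ∀ i, ∀ᵐ ω ∂P, specNorm (X i ω) ≤ r) (h0 : ∀ i a b, ∫ ω, X i ω a b ∂P = 0)
    (s : Finset ι) :
    ∫ ω, (NormedSpace.exp (∑ i ∈ s, X i ω)).trace ∂P ≤ d * Real.exp (r ^ 2) ^ s.card := by
  classical
  have hms : ∀ s : Finset ι, Measurable fun ω => ∑ i ∈ s, X i ω := fun s =>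
    Finset.measurable_fun_sum s fun i _ => hX i
  have hhs : ∀ s : Finset ι, ∀ᵐ ω ∂P, (∑ i ∈ s, X i ω).IsHermitian := by
    intro s
    have := (Filter.eventually_all_finset s).2 fun i _ => hh i
    filter_upwards [this] with ω hω
    exact isHermitian_sum s hω
  have hrs : ∀ s : Finset ι, ∀ᵐ ω ∂P, specNorm (∑ i ∈ s, X i ω) ≤ s.card * r := by
    intro s
    have := (Filter.eventually_all_finset s).2 fun i _ => hr i
    filter_upwards [this] with ω hω
    exact specNorm_sum_le s hω
  induction s using Finset.induction_on with
  | empty => simp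
  | insert i s his ih =>
    set S : Ω → Matrix (Fin d) (Fin d) ℝ := fun ω => ∑ j ∈ s, X j ω with hS
    have hindS : X i ⟂ᵢ[P] S := by
      have := (hind.indepFun_finsetSum_of_notMem hX his).symm
      convert this using 1
      ext1 ω
      simp [hS]
    have hexpS : ∀ᵐ ω ∂P, specNorm (NormedSpace.exp (S ω)) ≤ Real.exp (s.card * r) := by
      filter_upwards [hhs s, hrs s] with ω h1 h2
      exact (specNorm_exp_le h1).trans (Real.exp_le_exp.2 h2)
    obtain ⟨hI, hz⟩ := integral_trace_mul_eq_zero (hX i) (continuous_exp.measurable.comp (hms s))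
      (hindS.comp measurable_id continuous_exp.measurable) (hr i) hexpS (h0 i)
    have hIS := integrable_trace_exp (hms s) (hhs s) (hrs s)
    have hIB := integrable_trace_exp (hms (insert i s)) (hhs (insert i s)) (hrs (insert i s))
    have hpt : ∀ᵐ ω ∂P,
        (1 - r ^ 2 / 4) * (NormedSpace.exp (∑ j ∈ insert i s, X j ω)).trace ≤
          (1 + r ^ 2 / 2) * (NormedSpace.exp (S ω)).trace +
            (X i ω * NormedSpace.exp (S ω)).trace := by
      filter_upwards [hhs s, hhs (insert i s), hr i] with ω h1 h2 h3
      have h4 : ∑ j ∈ insert i s, X j ω - S ω = X i ω := by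
        rw [Finset.sum_insert his]; simp [hS]
      have := trace_exp_le h1 h2 (r := r) (by rw [h4]; exact h3)
      rwa [h4] at this
    have hle := integral_mono_ae (hIB.const_mul _) ((hIS.const_mul _).add hI) hpt
    rw [integral_const_mul, integral_add' (hIS.const_mul _) hI, integral_const_mul] at hle
    have hle' : (1 - r ^ 2 / 4) * ∫ ω, (NormedSpace.exp (∑ j ∈ insert i s, X j ω)).trace ∂P ≤
        (1 + r ^ 2 / 2) * ∫ ω, (NormedSpace.exp (S ω)).trace ∂P := by
      rwa [hz, add_zero] at hle
    have hr2 : r ^ 2 ≤ 1 := pow_le_one₀ hr0 hr1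
    have hpos : 0 < 1 - r ^ 2 / 4 := by linarith
    -- With x = r² ≤ 1: (1 - x/4)(1 + x) - (1 + x/2) = x(1 - x)/4 ≥ 0.
    have hcoef : 1 + r ^ 2 / 2 ≤ (1 - r ^ 2 / 4) * Real.exp (r ^ 2) := by
      have h1 := Real.add_one_le_exp (r ^ 2)
      have h2 : 1 + r ^ 2 / 2 ≤ (1 - r ^ 2 / 4) * (r ^ 2 + 1) := by
        nlinarith [sq_nonneg r]
      exact h2.trans (mul_le_mul_of_nonneg_left h1 hpos.le)
    have hnn : 0 ≤ (d : ℝ) * Real.exp (r ^ 2) ^ s.card := by positivity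
    refine le_of_mul_le_mul_left (hle'.trans ?_) hpos
    calc (1 + r ^ 2 / 2) * ∫ ω, (NormedSpace.exp (S ω)).trace ∂P
        ≤ (1 + r ^ 2 / 2) * (d * Real.exp (r ^ 2) ^ s.card) := by gcongr
      _ ≤ (1 - r ^ 2 / 4) * Real.exp (r ^ 2) * (d * Real.exp (r ^ 2) ^ s.card) := by gcongr
      _ = _ := by rw [Finset.card_insert_of_notMem his]; ring

/-- A matrix Hoeffding inequality for sums of independent centred bounded matrices. -/
lemma measure_specNorm_sum_le {ι : Type*} [Fintype ι] {X : ι → Ω → Matrix (Fin d) (Fin d) ℝ}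
    (hX : ∀ i, Measurable (X i)) (hind : iIndepFun X P)
    (hh : ∀ i, ∀ᵐ ω ∂P, (X i ω).IsHermitian) {r θ t : ℝ} (hθ : 0 < θ) (ht : 0 ≤ t)
    (hr0 : 0 ≤ r) (hr1 : θ * r ≤ 1)
    (hr : ∀ i, ∀ᵐ ω ∂P, specNorm (X i ω) ≤ r) (h0 : ∀ i a b, ∫ ω, X i ω a b ∂P = 0) :
    P.real {ω | t < specNorm (∑ i, X i ω)} ≤
      2 * d * Real.exp (Fintype.card ι * (θ * r) ^ 2 - θ * t) := by
  have hmgf : ∀ c : ℝ, |c| = θ →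
      Integrable (fun ω => (NormedSpace.exp (c • ∑ i, X i ω)).trace) P ∧
      ∫ ω, (NormedSpace.exp (c • ∑ i, X i ω)).trace ∂P ≤
        d * Real.exp ((θ * r) ^ 2) ^ Fintype.card ι := by
    intro c hc
    have hm : Measurable fun M : Matrix (Fin d) (Fin d) ℝ => c • M :=
      (continuous_const_smul c).measurable
    have hX' : ∀ i, Measurable fun ω => c • X i ω := fun i => hm.comp (hX i)
    have hh' : ∀ i, ∀ᵐ ω ∂P, (c • X i ω).IsHermitian := fun i => by
      filter_upwards [hh i] with ω hω
      rw [Matrix.IsHermitian, Matrix.conjTranspose_smul, hω.eq, star_trivial]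
    have hr' : ∀ i, ∀ᵐ ω ∂P, specNorm (c • X i ω) ≤ θ * r := fun i => by
      filter_upwards [hr i] with ω hω
      rw [specNorm_smul, hc]
      gcongr
    have h0' : ∀ i a b, ∫ ω, (c • X i ω) a b ∂P = 0 := fun i a b => by
      simp only [Matrix.smul_apply, smul_eq_mul]
      rw [integral_const_mul, h0, mul_zero]
    have hmain := integral_trace_exp_sum_le hX' (hind.comp (fun _ M => c • M) fun _ => hm) hh'
      (by positivity) hr1 hr' h0' Finset.univ
    simp only [← Finset.smul_sum] at hmain
    refine ⟨?_, hmain⟩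
    refine integrable_trace_exp (r := Fintype.card ι * (θ * r))
      (hm.comp (Finset.measurable_fun_sum _ fun i _ => hX i)) ?_ ?_
    · filter_upwards [ae_all_iff.2 hh'] with ω hω
      rw [Finset.smul_sum]
      exact isHermitian_sum _ fun i _ => hω i
    · filter_upwards [ae_all_iff.2 hr'] with ω hω
      rw [Finset.smul_sum]
      exact specNorm_sum_le _ fun i _ => hω i
  obtain ⟨hI1, h1⟩ := hmgf θ (abs_of_pos hθ)
  obtain ⟨hI2, h2⟩ := hmgf (-θ) (by rw [abs_neg, abs_of_pos hθ])
  set Z : Ω → ℝ := fun ω => (NormedSpace.exp (θ • ∑ i, X i ω)).trace +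
    (NormedSpace.exp ((-θ) • ∑ i, X i ω)).trace with hZ
  have hherm : ∀ᵐ ω ∂P, (θ • ∑ i, X i ω).IsHermitian := by
    filter_upwards [ae_all_iff.2 hh] with ω hω
    rw [Matrix.IsHermitian, Matrix.conjTranspose_smul,
      (isHermitian_sum _ fun i _ => hω i : (∑ i, X i ω).IsHermitian).eq, star_trivial]
  have hZ0 : 0 ≤ᵐ[P] Z := by
    filter_upwards [hherm] with ω hω
    have h3 := trace_exp_nonneg hω
    have h4 := trace_exp_nonneg hω.neg
    rw [← neg_smul] at h4
    exact add_nonneg h3 h4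
  have hmarkov := mul_meas_ge_le_integral_of_nonneg hZ0 (hI1.add hI2) (Real.exp (θ * t))
  have hsub : P.real {ω | t < specNorm (∑ i, X i ω)} ≤ P.real {ω | Real.exp (θ * t) ≤ Z ω} := by
    refine ENNReal.toReal_mono (measure_ne_top _ _) (measure_mono_ae ?_)
    filter_upwards [hherm] with ω hω hlt
    have hlt' : θ * t < specNorm (θ • ∑ i, X i ω) := by
      rw [specNorm_smul, abs_of_pos hθ]
      exact mul_lt_mul_of_pos_left hlt hθ
    have := exp_le_trace_exp_add_trace_exp_neg hω (by positivity) hlt'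
    rw [← neg_smul] at this
    exact this
  have hEZ : ∫ ω, Z ω ∂P ≤ 2 * d * Real.exp (Fintype.card ι * (θ * r) ^ 2) := by
    rw [hZ, integral_add hI1 hI2, Real.exp_nat_mul]
    linarith
  rw [Real.exp_sub, ← mul_div_assoc, le_div_iff₀ (Real.exp_pos _)]
  calc _ ≤ P.real {ω | Real.exp (θ * t) ≤ Z ω} * Real.exp (θ * t) := by gcongr
    _ ≤ ∫ ω, Z ω ∂P := by rw [mul_comm]; exact hmarkov
    _ ≤ _ := hEZ

end MatrixHoeffding

/-! ### Matrices with spectrum in [0, L]. -/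

section Range

variable {d : ℕ}

/-- `M` is symmetric and its quadratic form lies between `0` and `L ‖x‖²`. -/
def HasRange (L : ℝ) (M : Matrix (Fin d) (Fin d) ℝ) : Prop :=
  M.IsHermitian ∧ ∀ x, 0 ≤ ⟪x, Matrix.toEuclideanCLM (𝕜 := ℝ) M x⟫ ∧
    ⟪x, Matrix.toEuclideanCLM (𝕜 := ℝ) M x⟫ ≤ L * ‖x‖ ^ 2

lemma HasRange.posSemidef {L : ℝ} {M : Matrix (Fin d) (Fin d) ℝ} (h : HasRange L M) :
    M.PosSemidef := by
  refine Matrix.PosSemidef.of_dotProduct_mulVec_nonneg h.1 fun x => ?_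
  have := (h.2 (WithLp.toLp 2 x)).1
  rw [Matrix.inner_toEuclideanCLM] at this
  simpa using this

lemma HasRange.nonneg {L : ℝ} (hd : 0 < d) {M : Matrix (Fin d) (Fin d) ℝ}
    (h : HasRange L M) : 0 ≤ L := by
  have := h.2 (EuclideanSpace.single ⟨0, hd⟩ 1)
  simpa using this.1.trans this.2

lemma HasRange.specNorm_le {L : ℝ} (hL : 0 ≤ L) {M : Matrix (Fin d) (Fin d) ℝ}
    (h : HasRange L M) : specNorm M ≤ L :=
  specNorm_le_of_abs_inner_le h.1 hL fun x => by
    rw [abs_of_nonneg (h.2 x).1]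
    exact (h.2 x).2

/-- Both forms lie in the same interval of length L‖x‖², so centring costs L rather than the 2L of
the triangle inequality. -/
lemma HasRange.specNorm_sub_le {L : ℝ} (hL : 0 ≤ L) {M N : Matrix (Fin d) (Fin d) ℝ}
    (hM : HasRange L M) (hN : HasRange L N) : specNorm (M - N) ≤ L := by
  refine specNorm_le_of_abs_inner_le (hM.1.sub hN.1) hL fun x => ?_
  rw [map_sub, sub_apply, inner_sub_right]
  have h1 := hM.2 x
  have h2 := hN.2 x
  exact abs_le.2 ⟨by linarith, by linarith⟩

lemma hasRange_of_eigenvalues_le {L : ℝ} {M : Matrix (Fin d) (Fin d) ℝ} (hM : M.PosSemidef)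
    (h : ∀ x : ℝ, Module.End.HasEigenvalue (Matrix.toLin' M) x → x ≤ L) : HasRange L M := by
  refine ⟨hM.1, fun x => ⟨inner_toEuclideanCLM_nonneg hM x, ?_⟩⟩
  rw [inner_toEuclideanCLM_self_eq_sum hM.1, ← sum_inner_eigenvectorBasis_sq hM.1 x,
    Finset.mul_sum]
  refine Finset.sum_le_sum fun i _ => mul_le_mul_of_nonneg_right (h _ ?_) (sq_nonneg _)
  refine Module.End.hasEigenvalue_of_hasEigenvector
    (x := (hM.1.eigenvectorBasis i).ofLp) ⟨?_, ?_⟩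
  · rw [Module.End.mem_eigenspace_iff, Matrix.toLin'_apply, hM.1.mulVec_eigenvectorBasis]
  · intro h0
    have h1 := hM.1.eigenvectorBasis.norm_eq_one i
    rw [(WithLp.ofLp_eq_zero 2).1 h0, norm_zero] at h1
    exact zero_ne_one h1

lemma hasRange_avgMat {m : ℕ} (hm : 0 < m) {L : ℝ} {A : Fin m → Matrix (Fin d) (Fin d) ℝ}
    (hA : ∀ i, HasRange L (A i)) : HasRange L (avgMat A) := by
  have hm' : (0 : ℝ) < m := by exact_mod_cast hm
  refine ⟨isHermitian_avgMat fun i => (hA i).1, fun x => ?_⟩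
  rw [toEuclideanCLM_avgMat, smul_apply, sum_apply, inner_smul_right, inner_sum]
  refine ⟨mul_nonneg (by positivity) (Finset.sum_nonneg fun i _ => ((hA i).2 x).1), ?_⟩
  have : ∑ i, ⟪x, Matrix.toEuclideanCLM (𝕜 := ℝ) (A i) x⟫ ≤ m * (L * ‖x‖ ^ 2) := by
    simpa using Finset.sum_le_sum fun i (_ : i ∈ Finset.univ) => ((hA i).2 x).2
  calc _ ≤ 1 / (m : ℝ) * (m * (L * ‖x‖ ^ 2)) := by gcongr
    _ = _ := by field_simp

variable {Ω : Type*} [MeasurableSpace Ω] {P : Measure Ω} [IsProbabilityMeasure P]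

/-- The constraints are linear in the matrix and hence survive expectation. Applied to the mean,
this makes the centred summands bounded by L. -/
lemma hasRange_integral {L : ℝ} (hL : 0 ≤ L) {Y : Ω → Matrix (Fin d) (Fin d) ℝ}
    (hY : Measurable Y) (h : ∀ᵐ ω ∂P, HasRange L (Y ω)) :
    HasRange L (Matrix.of fun a b => ∫ ω, Y ω a b ∂P) := by
  have hint : ∀ a b, Integrable (fun ω => Y ω a b) P := fun a b =>
    integrable_entry hY (h.mono fun ω hω => hω.specNorm_le hL) a b
  refine ⟨?_, fun x => ?_⟩
  · ext a b
    simp only [Matrix.conjTranspose_apply, Matrix.of_apply, star_trivial]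
    refine integral_congr_ae (h.mono fun ω hω => ?_)
    simpa using hω.1.apply a b
  · have hexp : ∀ M : Matrix (Fin d) (Fin d) ℝ,
        ⟪x, Matrix.toEuclideanCLM (𝕜 := ℝ) M x⟫ = ∑ a, ∑ b, x a * (M a b * x b) := by
      intro M
      rw [Matrix.inner_toEuclideanCLM]
      simp [dotProduct, Matrix.mulVec, Finset.mul_sum]
    have hint2 : ∀ a b, Integrable (fun ω => x a * (Y ω a b * x b)) P := fun a b =>
      ((hint a b).mul_const _).const_mul _
    have heq : ⟪x, Matrix.toEuclideanCLM (𝕜 := ℝ) (Matrix.of fun a b => ∫ ω, Y ω a b ∂P) x⟫ =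
        ∫ ω, ⟪x, Matrix.toEuclideanCLM (𝕜 := ℝ) (Y ω) x⟫ ∂P := by
      simp_rw [hexp]
      rw [integral_finsetSum _ fun a _ => integrable_finsetSum _ fun b _ => hint2 a b]
      refine Finset.sum_congr rfl fun a _ => ?_
      rw [integral_finsetSum _ fun b _ => hint2 a b]
      refine Finset.sum_congr rfl fun b _ => ?_
      rw [integral_const_mul, integral_mul_const, Matrix.of_apply]
    have hintq : Integrable (fun ω => ⟪x, Matrix.toEuclideanCLM (𝕜 := ℝ) (Y ω) x⟫) P := by
      simp_rw [hexp]
      exact integrable_finsetSum _ fun a _ => integrable_finsetSum _ fun b _ => hint2 a b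
    rw [heq]
    refine ⟨integral_nonneg_of_ae (h.mono fun ω hω => (hω.2 x).1), ?_⟩
    have := integral_mono_ae hintq (integrable_const (L * ‖x‖ ^ 2))
      (h.mono fun ω hω => (hω.2 x).2)
    simpa using this

end Range

/-! ### The event on which all local Hessians are close. -/

section RelatedEvent

variable {d : ℕ} {Ω : Type*} [MeasurableSpace Ω] {P : Measure Ω} [IsProbabilityMeasure P]

lemma log_ratio_nonneg {K : ℕ} (hK : 0 < K) (hd : 0 < d) {α : ℝ} (hα : 0 < α) (hα1 : α ≤ 1) :
    0 ≤ Real.log ((K : ℝ) * d / α) := by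
  apply Real.log_nonneg
  rw [le_div_iff₀ hα, one_mul]
  have h1 : (1 : ℝ) ≤ K := by exact_mod_cast hK
  have h2 : (1 : ℝ) ≤ d := by exact_mod_cast hd
  nlinarith

lemma deltaParam_sq {K n : ℕ} (hK : 0 < K) (hd : 0 < d) (L : ℝ) {α : ℝ} (hα : 0 < α)
    (hα1 : α ≤ 1) :
    deltaParam L K d n α ^ 2 = 32 * L ^ 2 * Real.log ((K : ℝ) * d / α) / n := by
  have := log_ratio_nonneg hK hd hα hα1
  rw [deltaParam, Real.sq_sqrt (by positivity)]

/-- The deviation of an empirical average of bounded matrices from its mean. -/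
lemma measure_deviation_le {n : ℕ} (hn : 0 < n) {L δ : ℝ} (hL : 0 < L) (hδ : 0 < δ)
    (hδL : δ ≤ 4 * L) {A : Fin n → Ω → Matrix (Fin d) (Fin d) ℝ} (hA : ∀ i, Measurable (A i))
    (hind : iIndepFun A P) (hr : ∀ i, ∀ᵐ ω ∂P, HasRange L (A i ω))
    {M : Matrix (Fin d) (Fin d) ℝ} (hM : HasRange L M)
    (hmean : ∀ i a b, ∫ ω, A i ω a b ∂P = M a b) :
    P.real {ω | δ / 2 < specNorm (avgMat (fun i => A i ω) - M)} ≤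
      2 * d * Real.exp (-(n * δ ^ 2 / (16 * L ^ 2))) := by
  have hn' : (0 : ℝ) < n := by exact_mod_cast hn
  have hm : Measurable fun N : Matrix (Fin d) (Fin d) ℝ => N - M :=
    (continuous_id.sub continuous_const).measurable
  -- θ = δ/(4L²) minimizes nθ²L² - θnδ/2, and `θ * r ≤ 1` is exactly δ ≤ 4L.
  have hmain := measure_specNorm_sum_le (P := P) (X := fun i ω => A i ω - M) (r := L)
    (θ := δ / (4 * L ^ 2)) (t := n * (δ / 2))
    (fun i => hm.comp (hA i)) (hind.comp (fun _ N => N - M) fun _ => hm)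
    (fun i => (hr i).mono fun ω hω => hω.1.sub hM.1) (by positivity) (by positivity) hL.le
    (by rw [div_mul_eq_mul_div, div_le_one (by positivity)]; nlinarith)
    (fun i => (hr i).mono fun ω hω => hω.specNorm_sub_le hL.le hM)
    (fun i a b => by
      have hi : Integrable (fun ω => A i ω a b) P :=
        integrable_entry (hA i) ((hr i).mono fun ω hω => hω.specNorm_le hL.le) a b
      simp only [Matrix.sub_apply]
      rw [integral_sub hi (integrable_const _), hmean]
      simp)
  have hset : {ω | δ / 2 < specNorm (avgMat (fun i => A i ω) - M)} =
      {ω | n * (δ / 2) < specNorm (∑ i, (A i ω - M))} := by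
    ext ω
    have : ∑ i, (A i ω - M) = (n : ℝ) • (avgMat (fun i => A i ω) - M) := by
      rw [Finset.sum_sub_distrib, avgMat, smul_sub, smul_smul, mul_one_div_cancel hn'.ne',
        one_smul]
      simp [Nat.cast_smul_eq_nsmul]
    simp only [Set.mem_ofPred_eq]
    rw [this, specNorm_smul, abs_of_pos hn']
    exact (mul_lt_mul_iff_right₀ hn').symm
  rw [hset]
  refine hmain.trans_eq ?_
  rw [Fintype.card_fin]
  congr 2
  field_simp
  ring

/-- With probability at least `1 - α` the empirical averages are pairwise `δ`-close. -/
lemma exists_related_event {K n : ℕ} (hK : 0 < K) (hn : 0 < n) (hd : 0 < d) {L α : ℝ}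
    (hα : 0 < α) (hα1 : α ≤ 1) {A : Fin K → Fin n → Ω → Matrix (Fin d) (Fin d) ℝ}
    (hA : ∀ k i, Measurable (A k i)) (hind : ∀ k, iIndepFun (A k) P)
    (hid : ∀ k i k' i', IdentDistrib (A k i) (A k' i') P P)
    (hr : ∀ k i, ∀ᵐ ω ∂P, HasRange L (A k i ω)) :
    ∃ S : Set Ω, MeasurableSet S ∧ ENNReal.ofReal (1 - α) ≤ P S ∧ ∀ ω ∈ S,
      (∀ k, HasRange L (avgMat fun i => A k i ω)) ∧
      ∀ k k', specNorm ((avgMat fun i => A k i ω) - avgMat fun i => A k' i ω) ≤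
        deltaParam L K d n α := by
  set δ := deltaParam L K d n α with hδdef
  have hδ0 : 0 ≤ δ := Real.sqrt_nonneg _
  set N : Set Ω := {ω | ¬ ((∀ k, HasRange L (avgMat fun i => A k i ω)) ∧
      ∀ k k', specNorm ((avgMat fun i => A k i ω) - avgMat fun i => A k' i ω) ≤ δ)} with hN
  -- Measurability of `N` is not needed: the complement of its measurable hull serves as the event.
  suffices hmeas : P.real N ≤ α by
    refine ⟨(toMeasurable P N)ᶜ, (measurableSet_toMeasurable P N).compl, ?_, fun ω hω => ?_⟩
    · rw [prob_compl_eq_one_sub (measurableSet_toMeasurable P N), measure_toMeasurable,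
        ENNReal.ofReal_sub _ hα.le, ENNReal.ofReal_one]
      refine tsub_le_tsub_left ?_ _
      rw [← ofReal_measureReal]
      exact ENNReal.ofReal_le_ofReal hmeas
    · by_contra h
      exact hω (subset_toMeasurable P N h)
  have hrange : ∀ᵐ ω ∂P, ∀ k, HasRange L (avgMat fun i => A k i ω) := by
    refine ae_all_iff.2 fun k => ?_
    filter_upwards [ae_all_iff.2 (hr k)] with ω hω
    exact hasRange_avgMat hn hω
  have hL : 0 ≤ L := by
    obtain ⟨ω, hω⟩ := hrange.exists
    exact (hω ⟨0, hK⟩).nonneg hd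
  have hzero : (∀ᵐ ω ∂P, ω ∉ N) → P.real N ≤ α := fun h => by
    have h0 : P N = 0 := by
      rw [measure_eq_zero_iff_ae_notMem]
      exact h
    rw [measureReal_def, h0]
    simpa using hα.le
  -- For large δ the claim is almost sure, since two matrices with spectrum in [0, L] differ by at
  -- most L.
  rcases le_total (4 * L) δ with hc | hc
  · refine hzero ?_
    filter_upwards [hrange] with ω hω h
    exact h ⟨hω, fun k k' => ((hω k).specNorm_sub_le hL (hω k')).trans (by linarith)⟩
  -- One machine has nothing to compare. Excluding it gives K ≥ 2, which later absorbs the factor 2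
  -- of the two-sided tail.
  by_cases hK1 : K = 1
  · refine hzero ?_
    filter_upwards [hrange] with ω hω h
    refine h ⟨hω, fun k k' => ?_⟩
    have : k = k' := by subst hK1; exact Subsingleton.elim _ _
    rw [this, sub_self, specNorm, map_zero, norm_zero]
    exact hδ0
  rcases hδ0.eq_or_lt with hδz | hδpos
  · have hL0 : L = 0 ∨ Real.log ((K : ℝ) * d / α) = 0 := by
      have h1 := deltaParam_sq (n := n) hK hd L hα hα1
      rw [← hδdef, ← hδz] at h1
      have hn' : (n : ℝ) ≠ 0 := by exact_mod_cast hn.ne'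
      have h2 : 32 * L ^ 2 * Real.log ((K : ℝ) * d / α) = 0 := by
        rcases div_eq_zero_iff.1 (h1.symm.trans (by norm_num)) with h | h
        · exact h
        · exact absurd h hn'
      rcases mul_eq_zero.1 h2 with h | h
      · left; nlinarith
      · exact Or.inr h
    rcases hL0 with h | h
    · refine hzero ?_
      filter_upwards [hrange] with ω hω h'
      exact h' ⟨hω, fun k k' => ((hω k).specNorm_sub_le hL (hω k')).trans (by linarith)⟩
    · exfalso
      have hK2 : (2 : ℝ) ≤ K := by exact_mod_cast (by omega : 2 ≤ K)
      have hd1 : (1 : ℝ) ≤ d := by exact_mod_cast hd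
      have : 1 < (K : ℝ) * d / α := by
        rw [lt_div_iff₀ hα]; nlinarith
      exact (Real.log_pos this).ne' h
  have hLpos : 0 < L := by linarith
  set M : Matrix (Fin d) (Fin d) ℝ :=
    Matrix.of fun a b => ∫ ω, A ⟨0, hK⟩ ⟨0, hn⟩ ω a b ∂P with hM
  have hMr : HasRange L M := hasRange_integral hL (hA _ _) (hr _ _)
  have hdev : ∀ k, P.real {ω | δ / 2 < specNorm (avgMat (fun i => A k i ω) - M)} ≤
      2 * d * Real.exp (-(n * δ ^ 2 / (16 * L ^ 2))) := fun k =>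
    measure_deviation_le hn hLpos hδpos hc (hA k) (hind k) (hr k) hMr fun i a b =>
      ((hid k i ⟨0, hK⟩ ⟨0, hn⟩).comp (measurable_entry a b)).integral_eq
  have hsub : P.real N ≤ P.real (⋃ k, {ω | δ / 2 < specNorm (avgMat (fun i => A k i ω) - M)}) := by
    refine ENNReal.toReal_mono (measure_ne_top _ _) (measure_mono_ae ?_)
    filter_upwards [hrange] with ω hω hωN
    by_contra hnot
    refine hωN ⟨hω, fun k k' => ?_⟩
    have hsmall : ∀ k, specNorm (avgMat (fun i => A k i ω) - M) ≤ δ / 2 := fun k => by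
      by_contra! hk
      exact hnot (Set.mem_iUnion.2 ⟨k, hk⟩)
    have hsplit : (avgMat fun i => A k i ω) - (avgMat fun i => A k' i ω) =
        ((avgMat fun i => A k i ω) - M) + (-1 : ℝ) • ((avgMat fun i => A k' i ω) - M) := by
      rw [neg_one_smul]; abel
    rw [hsplit]
    refine (specNorm_add_le _ _).trans ?_
    rw [specNorm_smul, abs_neg, abs_one, one_mul]
    linarith [hsmall k, hsmall k']
  have hn' : (0 : ℝ) < n := by exact_mod_cast hn
  have hK2 : (2 : ℝ) ≤ K := by exact_mod_cast (by omega : 2 ≤ K)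
  have hd1 : (1 : ℝ) ≤ d := by exact_mod_cast hd
  -- The constant 32 makes the exponent -2 log(Kd/α); this square lets the union bound total
  -- 2α²/(Kd) ≤ α.
  have hexp : Real.exp (-(n * δ ^ 2 / (16 * L ^ 2))) = (α / (K * d)) ^ 2 := by
    rw [hδdef, deltaParam_sq hK hd L hα hα1]
    have h1 : -(n * (32 * L ^ 2 * Real.log ((K : ℝ) * d / α) / n) / (16 * L ^ 2)) =
        (2 : ℕ) * Real.log ((K : ℝ) * d / α)⁻¹ := by
      rw [Real.log_inv]
      field_simp
      ring
    rw [h1, Real.exp_nat_mul, Real.exp_log (by positivity), inv_div]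
  calc P.real N ≤ ∑ k, P.real {ω | δ / 2 < specNorm (avgMat (fun i => A k i ω) - M)} :=
        hsub.trans (measureReal_iUnion_fintype_le _)
    _ ≤ ∑ _k : Fin K, 2 * d * (α / (K * d)) ^ 2 := by
        rw [← hexp]
        exact Finset.sum_le_sum fun k _ => hdev k
    _ = 2 * α * (α / (K * d)) := by
        rw [Finset.sum_const, Finset.card_univ, Fintype.card_fin, nsmul_eq_mul]
        field_simp
    _ ≤ α := by
        have : α / (K * d) ≤ 1 / 2 := by
          rw [div_le_div_iff₀ (by positivity) (by norm_num)]
          nlinarith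
        nlinarith

end RelatedEvent

end InexactDANE

/-! ### Assembly of the two parts. -/

theorem corollary4 :
    ∃ C : ℝ, 0 < C ∧
      ∀ (Ω : Type*) [MeasurableSpace Ω] (P : Measure Ω) [IsProbabilityMeasure P]
        (K n d : ℕ) (_ : 0 < K) (_ : 0 < n) (_ : 0 < d) (L α : ℝ) (_ : 0 < α) (_ : α ≤ 1)
        (A : Fin K → Fin n → Ω → Matrix (Fin d) (Fin d) ℝ)
        (_ : ∀ k i, Measurable (A k i))
        (_ : ∀ k, iIndepFun (A k) P)
        (_ : ∀ k i k' i', IdentDistrib (A k i) (A k' i') P P)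
        (_ : ∀ k i, ∀ᵐ ω ∂P, (A k i ω).PosSemidef ∧
          ∀ x : ℝ, Module.End.HasEigenvalue (Matrix.toLin' (A k i ω)) x → x ≤ L),
        ∃ S : Set Ω, MeasurableSet S ∧ ENNReal.ofReal (1 - α) ≤ P S ∧
          ∀ ω ∈ S, ∀ H : Fin K → Matrix (Fin d) (Fin d) ℝ,
            (∀ k, H k = InexactDANE.avgMat fun i => A k i ω) →
            ∀ δ : ℝ, δ = InexactDANE.deltaParam L K d n α →
            (∀ k k', InexactDANE.specNorm (H k - H k') ≤ δ) ∧
            (∀ l : Fin K → EuclideanSpace ℝ (Fin d), (∀ k k', ‖l k - l k'‖ ≤ δ) →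
              InexactDANE.DeltaRelated H l δ) ∧
            (∀ (l : Fin K → EuclideanSpace ℝ (Fin d))
              (F : Fin K → EuclideanSpace ℝ (Fin d) → ℝ) (f : EuclideanSpace ℝ (Fin d) → ℝ),
              (∀ k, F k = InexactDANE.quad (H k) (l k)) → f = InexactDANE.avgFun F →
              ∀ lam : ℝ, 0 < lam →
              (InexactDANE.avgMat H - lam • (1 : Matrix (Fin d) (Fin d) ℝ)).PosSemidef →
              ∀ (what w0 : EuclideanSpace ℝ (Fin d)) (w : ℕ → EuclideanSpace ℝ (Fin d)),
              IsMinOn f Set.univ what →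
              InexactDANE.IsIterates F 1 (InexactDANE.muParam lam δ)
                (InexactDANE.gammaParam lam δ) w0 w →
              ∀ ε : ℝ, 0 < ε → ∀ t : ℕ,
              C * max 1 ((L / lam) ^ 2 / n * Real.log ((K : ℝ) * d / α)) *
                  Real.log (L * ‖w0 - what‖ ^ 2 / ε) ≤ t →
              f (w t) ≤ f what + ε) := by
  refine ⟨192, by norm_num, ?_⟩
  intro Ω _ P _ K n d hK hn hd L α hα hα1 A hA hind hid hr
  have hr' : ∀ k i, ∀ᵐ ω ∂P, InexactDANE.HasRange L (A k i ω) := fun k i =>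
    (hr k i).mono fun ω hω => InexactDANE.hasRange_of_eigenvalues_le hω.1 hω.2
  obtain ⟨S, hS, hPS, hgood⟩ :=
    InexactDANE.exists_related_event hK hn hd hα hα1 hA hind hid hr'
  refine ⟨S, hS, hPS, fun ω hω H hH δ hδ => ?_⟩
  obtain ⟨hrange, hrel⟩ := hgood ω hω
  obtain rfl : H = fun k => InexactDANE.avgMat fun i => A k i ω := funext hH
  rw [← hδ] at hrel
  refine ⟨hrel, fun l hl k k' => ⟨hrel k k', hl k k'⟩, ?_⟩
  intro l F f hF hf lam hlam hpsd what w0 w hmin hit ε hε t ht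
  obtain rfl : F = fun k => InexactDANE.quad (InexactDANE.avgMat fun i => A k i ω) (l k) :=
    funext hF
  subst hf
  have hL : 0 ≤ L := (hrange ⟨0, hK⟩).nonneg hd
  refine InexactDANE.avgFun_iterate_le hK (fun k => (hrange k).posSemidef)
    (fun k => (hrange k).specNorm_le hL) hrel (by rw [hδ]; exact Real.sqrt_nonneg _) hlam
    (le_max_left 1 _) ?_ hpsd hmin hit hε ht
  -- δ² equals 32 λ² times the second argument of the maximum.
  rw [hδ, InexactDANE.deltaParam_sq hK hd L hα hα1]
  calc 32 * L ^ 2 * Real.log ((K : ℝ) * d / α) / n =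
        32 * lam ^ 2 * ((L / lam) ^ 2 / n * Real.log ((K : ℝ) * d / α)) := by
        field_simp
    _ ≤ _ := by
        gcongr
        exact le_max_right _ _
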